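/- **Definitions.** Let $A$ be a commutative ring, $M$ an $A$-module and $\phi\colon A\to M$ an $A$-linear map, and suppose that some $A$-regular element $q\in A$ satisfies $qM=0$. Then $\operatorname{Ext}^1_A(M,A)\cong\operatorname{Hom}_A(M,A/q)$ and $\operatorname{Ext}^1_A(\operatorname{Ext}^1_A(M,A),A)\cong\operatorname{Hom}_A(\operatorname{Hom}_A(M,A/q),A/q)$. The image of $\phi(1)$ under the double dual map $M\to\operatorname{Hom}_A(\operatorname{Hom}_A(M,A/q),A/q)$ therefore corresponds to an extension $0\to A\xrightarrow{i}Q\to\operatorname{Ext}^1_A(M,A)\to 0$. Put $$R_1=\operatorname{Sym}_A(Q)/(i(1_A)-1),\qquad T=\{t\in A: t \text{ is both } A\text{-regular and } M\text{-regular}\},$$ $$J=\{u\in R_1: tu=0\text{ for some }t\in T\},\qquad \operatorname{unpr}_A\phi=R_1/J.$$ Up to isomorphism this does not depend on $q$. For an ideal $I\subset A$ that contains an $A$-regular element $q$, let $\operatorname{unpr}_A I$ be the unprojection algebra of the projection $A\to A/I$. In this case $Q\cong\operatorname{Hom}_A(I,A)$, where $h\in\operatorname{Hom}_A(I,A)$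 corresponds to the pair of $h(q)$ and the map $A/I\to A/q$, $x\mapsto x\,h(q)$, and $i(1_A)$ corresponds to the inclusion map $i\colon I\to A$. Thus $R_1\cong\operatorname{Sym}_A(\operatorname{Hom}_A(I,A))/(i-1)$. **Theorem.** Let $\mathcal O_X$ be a Gorenstein local ring, and let $I_D=(f_1,\dots,f_r)\subset\mathcal O_X$ be an ideal of codimension (height) one such that $\mathcal O_D=\mathcal O_X/I_D$ is also Gorenstein. Let $\tilde s\in\operatorname{Hom}_{\mathcal O_X}(I_D,\mathcal O_X)$ be a homomorphism whose class generates the $\mathcal O_X$-module $\operatorname{Hom}_{\mathcal O_X}(I_D,\mathcal O_X)/\mathcal O_X$, where $\mathcal O_X$ is embedded as the multiples of the inclusion map $i\colon I_D\to\mathcal O_X$, and put $g_j=\tilde s(f_j)$ for $j=1,\dots,r$. Then $I_D$ contains an $\mathcal O_X$-regular element, and for every choice of such an element $q$ in the definition of $\operatorname{unpr}_{\mathcal O_X}I_D$ the following hold. 1. The homomorphism of $\mathcal O_X$-algebras $\psi^2\colon\mathcal O_X[S]\to\operatorname{unpr}_{\mathcal O_X}I_D$ that sends $S$ to the class of $\tilde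 s$ is surjective, and $$\ker\psi^2=(Sf_1-g_1,\dots,Sf_r-g_r).$$ 2. Hence $\operatorname{unpr}_{\mathcal O_X}I_D$ agrees with the Kustin--Miller unprojection ring of Papadakis and Reid: there is an isomorphism of $\mathcal O_X$-algebras $\mathcal O_X[S]/(Sf_1-g_1,\dots,Sf_r-g_r)\cong\operatorname{unpr}_{\mathcal O_X}I_D$ that sends the class of $S$ to the class of $\tilde s$. 3. There is an isomorphism of $\mathcal O_X$-algebras $$R_1=\operatorname{Sym}_{\mathcal O_X}(\operatorname{Hom}_{\mathcal O_X}(I_D,\mathcal O_X))/(i-1)\;\cong\;\operatorname{unpr}_{\mathcal O_X}I_D$$ that sends the class of each $h\in\operatorname{Hom}_{\mathcal O_X}(I_D,\mathcal O_X)$ to the class of $h$. -/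

import Mathlib

universe u

open CategoryTheory Polynomial

/-- A Gorenstein local ring: a Noetherian local ring of finite injective dimension as a module
over itself. -/
structure IsGorensteinLocalRing (A : Type u) [CommRing A] : Prop where
  isLocalRing : IsLocalRing A
  isNoetherianRing : IsNoetherianRing A
  finite_injectiveDimension : ∃ n : ℕ, HasInjectiveDimensionLE (ModuleCat.of A A) n

namespace Unprojection

noncomputable section

variable {A : Type u} [CommRing A]

/-- For an `A`-module `Q` with a distinguished element `e` (the image of `1` under a map
`A → Q`), the `A`-algebra `R₁ = Sym_A Q / (e - 1)`. -/
abbrev R1 (Q : Type u) [AddCommGroup Q] [Module A Q] (e : Q) : Type u :=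
  SymmetricAlgebra A Q ⧸ Ideal.span {SymmetricAlgebra.ι A Q e - 1}

/-- The natural map `Q → Sym_A Q / (e - 1)`. -/
def R1.ι {Q : Type u} [AddCommGroup Q] [Module A Q] (e : Q) : Q →ₗ[A] R1 (A := A) Q e :=
  (Ideal.Quotient.mkₐ A (Ideal.span {SymmetricAlgebra.ι A Q e - 1})).toLinearMap ∘ₗ
    SymmetricAlgebra.ι A Q

/-- The multiplicatively closed set `T` of the elements of `A` that are both `A`-regular and
`M`-regular. -/
def regularSubmonoid (A : Type u) [CommRing A] (M : Type u) [AddCommGroup M] [Module A M] :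
    Submonoid A where
  carrier := {t | IsSMulRegular A t ∧ IsSMulRegular M t}
  one_mem' := ⟨IsSMulRegular.one A, IsSMulRegular.one M⟩
  mul_mem' ha hb := ⟨ha.1.mul hb.1, ha.2.mul hb.2⟩

/-- For a submonoid `T` of `A` and an `A`-algebra `B`, the ideal
`J = {u ∈ B : t u = 0 for some t ∈ T}`. -/
def torsionIdeal (T : Submonoid A) (B : Type u) [CommRing B] [Algebra A B] : Ideal B where
  carrier := {v | ∃ t ∈ T, t • v = 0}
  zero_mem' := ⟨1, T.one_mem, by simp⟩
  add_mem' := by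
    rintro a b ⟨t, ht, hta⟩ ⟨r, hr, hrb⟩
    refine ⟨t * r, T.mul_mem ht hr, ?_⟩
    rw [smul_add, mul_comm, mul_smul, hta, mul_comm, mul_smul, hrb, smul_zero, smul_zero, add_zero]
  smul_mem' := by
    rintro c a ⟨t, ht, hta⟩
    exact ⟨t, ht, by rw [smul_eq_mul, ← mul_smul_comm, hta, mul_zero]⟩

section General

variable {M : Type u} [AddCommGroup M] [Module A M] (φ : A →ₗ[A] M) (q : A)

/-- Let `φ : A → M` be `A`-linear and let `q` be an `A`-regular element with `q M = 0`, so that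
`Ext¹(M, A) = Hom(M, A/q)`.  The image of `φ(1)` under the double dual map
`M → Hom(Hom(M, A/q), A/q)` is the evaluation map `g : α ↦ α(φ(1))`. -/
def evalAtOne : (M →ₗ[A] A ⧸ Ideal.span {q}) →ₗ[A] A ⧸ Ideal.span {q} :=
  LinearMap.applyₗ (φ 1)

/-- The middle term `Q` of the extension `0 → A → Q → Hom(M, A/q) → 0` that corresponds to
`g = evalAtOne φ q`: the pull-back along `g` of the exact sequence `0 → A → A → A/q → 0`, whose
first map is multiplication by `q`. -/
abbrev ExtModule : Type u :=
  LinearMap.eqLocus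
    ((Ideal.Quotient.mkₐ A (Ideal.span {q})).toLinearMap ∘ₗ
      LinearMap.fst A A (M →ₗ[A] A ⧸ Ideal.span {q}))
    (evalAtOne φ q ∘ₗ LinearMap.snd A A (M →ₗ[A] A ⧸ Ideal.span {q}))

/-- The map `i : A → Q`, `b ↦ (q b, 0)`, of the extension. -/
def ExtModule.incl : A →ₗ[A] ExtModule φ q :=
  LinearMap.codRestrict _ (LinearMap.prod (LinearMap.mulLeft A q) 0) fun b => by
    have h : (Ideal.Quotient.mk (Ideal.span {q})) (q * b) = 0 :=
      Ideal.Quotient.eq_zero_iff_mem.2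
        (Ideal.mul_mem_right b _ (Ideal.subset_span (Set.mem_singleton q)))
    simp [LinearMap.mem_eqLocus, h]

/-- The map `Q → Hom(M, A/q)` of the extension. -/
def ExtModule.proj : ExtModule φ q →ₗ[A] (M →ₗ[A] A ⧸ Ideal.span {q}) :=
  LinearMap.snd A A _ ∘ₗ Submodule.subtype _

/-- `0 → A → Q → Hom(M, A/q) → 0` is an extension, and the homomorphism
`Hom(M, A/q) → A/q` that belongs to it (lift `α` to `x ∈ Q`, write `q x = i(b)`, and take the
class of `b`) is the evaluation map. -/
theorem ExtModule.isExtension (hq : IsSMulRegular A q) (hM : ∀ m : M, q • m = 0) :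
    Function.Injective (ExtModule.incl φ q) ∧
      Function.Exact (ExtModule.incl φ q) (ExtModule.proj φ q) ∧
      Function.Surjective (ExtModule.proj φ q) ∧
      ∀ x : ExtModule φ q, ∃ b : A, q • x = ExtModule.incl φ q b ∧
        Ideal.Quotient.mk (Ideal.span {q}) b = evalAtOne φ q (ExtModule.proj φ q x) := by
  refine ⟨?_, ?_, ?_, ?_⟩
  · intro a b h
    exact hq (congrArg (fun x : ExtModule φ q => x.1.1) h)
  · rintro ⟨⟨b, α⟩, h⟩
    constructor
    · intro h0
      obtain rfl : α = 0 := h0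
      have h' : (Ideal.Quotient.mk (Ideal.span {q})) b = 0 := by
        simpa [LinearMap.mem_eqLocus] using h
      rw [Ideal.Quotient.eq_zero_iff_mem, Ideal.mem_span_singleton'] at h'
      obtain ⟨c, hc⟩ := h'
      refine ⟨c, Subtype.ext (Prod.ext ?_ rfl)⟩
      exact (mul_comm q c).trans hc
    · rintro ⟨c, hc⟩
      exact (congrArg (fun x : ExtModule φ q => x.1.2) hc).symm
  · intro α
    obtain ⟨b, hb⟩ := Ideal.Quotient.mk_surjective (evalAtOne φ q α)
    exact ⟨⟨(b, α), hb⟩, rfl⟩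
  · rintro ⟨⟨b, α⟩, h⟩
    refine ⟨b, Subtype.ext (Prod.ext rfl ?_), h⟩
    refine LinearMap.ext fun m => ?_
    change q • α m = 0
    rw [← map_smul, hM, map_zero]

/-- The unprojection algebra `unpr_A φ = R₁ / J` of `φ : A → M`, computed with an `A`-regular
element `q` such that `q M = 0`. -/
abbrev unpr : Type u :=
  R1 (A := A) (ExtModule φ q) (ExtModule.incl φ q 1) ⧸
    torsionIdeal (regularSubmonoid A M) (R1 (A := A) (ExtModule φ q) (ExtModule.incl φ q 1))

/-- The natural map `Q → unpr_A φ`. -/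
def unpr.ι : ExtModule φ q →ₗ[A] unpr φ q :=
  (Ideal.Quotient.mkₐ A
      (torsionIdeal (regularSubmonoid A M)
        (R1 (A := A) (ExtModule φ q) (ExtModule.incl φ q 1)))).toLinearMap ∘ₗ
    R1.ι (ExtModule.incl φ q 1)

end General

section Ideals

variable (I : Ideal A)

/-- The projection map `A → A/I`. -/
abbrev projection : A →ₗ[A] A ⧸ I := (Ideal.Quotient.mkₐ A I).toLinearMap

/-- The unprojection algebra of the ideal `I`: the unprojection algebra of the projection map
`A → A/I`, computed with an `A`-regular element `q ∈ I`. -/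
abbrev unprIdeal (q : A) : Type u := unpr (projection I) q

/-- The identification of `Hom(I, A)` with the middle term `Q` of the extension belonging to
`A → A/I`; it sends `h : I → A` to the pair of `h(q)` and the map
`A/I → A/q`, `x ↦ x h(q)`. -/
def homToExt (q : A) (hq : q ∈ I) : (I →ₗ[A] A) →ₗ[A] ExtModule (projection I) q where
  toFun h :=
    ⟨(h ⟨q, hq⟩, Submodule.liftQ I
      (LinearMap.toSpanSingleton A (A ⧸ Ideal.span {q})
        (Ideal.Quotient.mk (Ideal.span {q}) (h ⟨q, hq⟩)))
      (by
        intro x hx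
        have h1 : x * h ⟨q, hq⟩ = q * h ⟨x, hx⟩ := by
          rw [← smul_eq_mul, ← smul_eq_mul, ← map_smul, ← map_smul]
          exact congrArg h (Subtype.ext (mul_comm x q))
        change x • (Ideal.Quotient.mk (Ideal.span {q})) (h ⟨q, hq⟩) = 0
        change (Ideal.Quotient.mk (Ideal.span {q})) (x * h ⟨q, hq⟩) = 0
        rw [h1, Ideal.Quotient.eq_zero_iff_mem]
        exact Ideal.mul_mem_right _ _ (Ideal.subset_span (Set.mem_singleton q)))),
      (one_smul A (Ideal.Quotient.mk (Ideal.span {q}) (h ⟨q, hq⟩))).symm⟩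
  map_add' h k := by
    refine Subtype.ext (Prod.ext rfl ?_)
    refine LinearMap.ext fun y => ?_
    obtain ⟨x, rfl⟩ := Ideal.Quotient.mk_surjective y
    exact smul_add x (Ideal.Quotient.mk (Ideal.span {q}) (h ⟨q, hq⟩))
      (Ideal.Quotient.mk (Ideal.span {q}) (k ⟨q, hq⟩))
  map_smul' c h := by
    refine Subtype.ext (Prod.ext rfl ?_)
    refine LinearMap.ext fun y => ?_
    obtain ⟨x, rfl⟩ := Ideal.Quotient.mk_surjective y
    exact smul_comm x c (Ideal.Quotient.mk (Ideal.span {q}) (h ⟨q, hq⟩))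

/-- The natural map `Hom(I, A) → unpr_A I`. -/
def homToUnpr (q : A) (hq : q ∈ I) : (I →ₗ[A] A) →ₗ[A] unprIdeal I q :=
  unpr.ι (projection I) q ∘ₗ homToExt I q hq

/-- The map `A[S] → unpr_A I` of `A`-algebras that sends `S` to the class of `s : I → A`. -/
def psi2 (q : A) (hq : q ∈ I) (s : I →ₗ[A] A) : A[X] →ₐ[A] unprIdeal I q :=
  Polynomial.aeval (homToUnpr I q hq s)

/-- The algebra `R₁ = Sym_A Hom(I, A) / (i - 1)`, where `i : I → A` is the inclusion map. -/
abbrev idealR1 : Type u := R1 (A := A) (I →ₗ[A] A) (Submodule.subtype I)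

/-- The class of `s : I → A` generates `Hom(I, A) / A`, where `A` is embedded in `Hom(I, A)` as
the multiples of the inclusion map. -/
def GeneratesHomModA (s : I →ₗ[A] A) : Prop :=
  Submodule.span A {(Submodule.span A {Submodule.subtype I}).mkQ s} = ⊤

end Ideals

/-- The ideal `(S fᵢ - gᵢ)` of `A[S]`. -/
def kustinMillerIdeal {r : ℕ} (f g : Fin r → A) : Ideal A[X] :=
  Ideal.span (Set.range fun i => X * C (f i) - C (g i))

/-- The Kustin--Miller unprojection ring `A[S] / (S fᵢ - gᵢ)` of Papadakis and Reid. -/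
abbrev KustinMillerUnprojection {r : ℕ} (f g : Fin r → A) : Type u :=
  A[X] ⧸ kustinMillerIdeal f g

end

end Unprojection

/-! Everything rests on two facts: `I` contains a regular element `q`, and `b • s ∈ A · i` forces `b
∈ I`. Given these, `Hom(I, A)` is generated by `i` and `s`, and its relations are exactly `b s =
s(b) i` with `b ∈ I`. Therefore `R₁ = A[S]/(S b - s(b) : b ∈ I)`, which is the Kustin–Miller ring
(`exists_linearMap_kustinMillerUnprojection`, `R1.ker_aeval`). Comparing top coefficients shows that
this ring has no `T`-torsion (`mem_kustinMillerIdeal_of_C_mul_mem`), so `J = 0` and `unpr = R₁`.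

The second fact says that `Hom(I, A)/A ≅ Ext¹(A/I, A)`, the canonical module of the Cohen–Macaulay
ring `A/I`, has annihilator `I`. This part of local duality is derived from the groups `Extⁱ(A/J,
A)` alone, by means of the long exact sequences of `0 → A/(J : x) → A/J → A/(J + xA) → 0` and
Nakayama's lemma. Let `n` be the top degree with `Extⁿ(A/𝔪, A) ≠ 0`. Then `A` is Cohen–Macaulay of
dimension `n`, and `Extⁿ(A/J, A)` is faithful over `A/J` for `𝔪`-primary `J`
(`IsTopExtDegree.mem_of_smul_eq_zero`). Faithfulness passes up along a regular sequence on `A/I` to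
`Ext¹(A/I, A)` (`IsTopExtDegree.mem_of_smul_eq_zero_of_regularChain`). -/

namespace Unprojection

/-! ### Ext of cyclic modules and the long exact sequence of a colon ideal. -/

section CyclicExt

open Abelian

variable {A : Type u} [CommRing A]

/-- The module `Extⁱ(A/J, N)`. -/
abbrev cyclicExt (N : ModuleCat.{u} A) (i : ℕ) (J : Ideal A) : Type u :=
  Ext (ModuleCat.of A (A ⧸ J)) N i

/-- Multiplication by `x` as a map `A/K → A/J`, where `xK ⊆ J`. -/
def mulQuotient {J K : Ideal A} {x : A} (h : ∀ a ∈ K, x * a ∈ J) : (A ⧸ K) →ₗ[A] A ⧸ J :=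
  Submodule.mapQ K J (LinearMap.mulLeft A x) h

/-- The complex `A/K → A/J → A/(J + xA)`, whose first map is multiplication by `x`. -/
noncomputable abbrev colonComplex {J K : Ideal A} {x : A} (h : ∀ a ∈ K, x * a ∈ J) :
    ShortComplex (ModuleCat.{u} A) where
  X₁ := ModuleCat.of A (A ⧸ K)
  X₂ := ModuleCat.of A (A ⧸ J)
  X₃ := ModuleCat.of A (A ⧸ (J ⊔ Ideal.span {x}))
  f := ModuleCat.ofHom (mulQuotient h)
  g := ModuleCat.ofHom (Submodule.factor le_sup_left)
  zero := by
    refine ModuleCat.hom_ext (LinearMap.ext fun y => ?_)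
    obtain ⟨a, rfl⟩ := Submodule.Quotient.mk_surjective _ y
    change Submodule.Quotient.mk (x * a) = 0
    rw [Submodule.Quotient.mk_eq_zero]
    exact Ideal.mem_sup_right (Ideal.mul_mem_right _ _ (Ideal.mem_span_singleton_self x))

theorem colonComplex_shortExact {J K : Ideal A} {x : A} (h : ∀ a, a ∈ K ↔ x * a ∈ J) :
    (colonComplex fun a => (h a).1).ShortExact := by
  refine ModuleCat.shortComplex_shortExact _ ?_ ?_ ?_
  · intro y
    obtain ⟨a, rfl⟩ := Submodule.Quotient.mk_surjective _ y
    change Submodule.Quotient.mk a = 0 ↔ _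
    rw [Submodule.Quotient.mk_eq_zero]
    constructor
    · intro ha
      obtain ⟨j, hj, c, hc, rfl⟩ := Submodule.mem_sup.1 ha
      obtain ⟨c, rfl⟩ := Ideal.mem_span_singleton'.1 hc
      refine ⟨Submodule.Quotient.mk c, ?_⟩
      change Submodule.Quotient.mk (x * c) = _
      rw [Submodule.Quotient.eq]
      have : x * c - (j + c * x) = -j := by ring
      rw [this]
      exact neg_mem hj
    · rintro ⟨z, hz⟩
      obtain ⟨c, rfl⟩ := Submodule.Quotient.mk_surjective _ z
      replace hz : (Submodule.Quotient.mk (x * c) : A ⧸ J) = Submodule.Quotient.mk a := hz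
      rw [Submodule.Quotient.eq] at hz
      have : a = -(x * c - a) + x * c := by ring
      rw [this]
      exact add_mem (neg_mem (Ideal.mem_sup_left hz))
        (Ideal.mem_sup_right (Ideal.mul_mem_right _ _ (Ideal.mem_span_singleton_self x)))
  · rw [← LinearMap.ker_eq_bot, LinearMap.ker_eq_bot']
    intro y hy
    obtain ⟨a, rfl⟩ := Submodule.Quotient.mk_surjective _ y
    replace hy : (Submodule.Quotient.mk (x * a) : A ⧸ J) = 0 := hy
    rw [Submodule.Quotient.mk_eq_zero] at hy ⊢
    exact (h a).2 hy
  · exact Submodule.factor_surjective le_sup_left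

variable {N : ModuleCat.{u} A} {i : ℕ} {J K : Ideal A} {x : A}

/-- The map `Extⁱ(A/J, N) → Extⁱ(A/K, N)` induced by multiplication by `x`. -/
noncomputable def extMul (N : ModuleCat.{u} A) (i : ℕ) (h : ∀ a, a ∈ K ↔ x * a ∈ J) :
    cyclicExt N i J →ₗ[A] cyclicExt N i K :=
  (Ext.mk₀ (colonComplex fun a => (h a).1).f).precompOfLinear A N (zero_add i)

/-- The map `Extⁱ(A/J', N) → Extⁱ(A/J, N)` induced by the projection `A/J → A/J'`. -/
noncomputable def extProj (N : ModuleCat.{u} A) (i : ℕ) {J J' : Ideal A} (h : J ≤ J') :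
    cyclicExt N i J' →ₗ[A] cyclicExt N i J :=
  (Ext.mk₀ (ModuleCat.ofHom (Submodule.factor h))).precompOfLinear A N (zero_add i)

/-- The connecting map `Extⁱ(A/K, N) → Extⁱ⁺¹(A/(J + xA), N)`. -/
noncomputable def extDelta (N : ModuleCat.{u} A) (i : ℕ) (h : ∀ a, a ∈ K ↔ x * a ∈ J) :
    cyclicExt N i K →ₗ[A] cyclicExt N (i + 1) (J ⊔ Ideal.span {x}) :=
  (colonComplex_shortExact h).extClass.precompOfLinear A N (add_comm 1 i)

theorem extMul_eq_zero (h : ∀ a, a ∈ K ↔ x * a ∈ J) {y : cyclicExt N i J}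
    (hy : extMul N i h y = 0) : ∃ z : cyclicExt N i (J ⊔ Ideal.span {x}), extProj N i le_sup_left z = y :=
  Ext.contravariant_sequence_exact₂ (colonComplex_shortExact h) N y hy

theorem extDelta_eq_zero (h : ∀ a, a ∈ K ↔ x * a ∈ J) {y : cyclicExt N i K}
    (hy : extDelta N i h y = 0) : ∃ z, extMul N i h z = y :=
  Ext.contravariant_sequence_exact₁ (colonComplex_shortExact h) N y (add_comm 1 i) hy

theorem extProj_eq_zero (h : ∀ a, a ∈ K ↔ x * a ∈ J)
    {y : cyclicExt N (i + 1) (J ⊔ Ideal.span {x})} (hy : extProj N (i + 1) le_sup_left y = 0) :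
    ∃ z, extDelta N i h z = y :=
  Ext.contravariant_sequence_exact₃ (colonComplex_shortExact h) N y hy (add_comm 1 i)

theorem extProj_zero_injective {J J' : Ideal A} (h : J ≤ J') :
    Function.Injective (extProj N 0 h) := by
  have : Epi (ModuleCat.ofHom (Submodule.factor h)) :=
    (ModuleCat.epi_iff_surjective _).2 (Submodule.factor_surjective h)
  exact Ext.precomp_mk₀_injective_of_epi N (ModuleCat.ofHom (Submodule.factor h))

theorem extProj_comp {J J' J'' : Ideal A} (h : J ≤ J') (h' : J' ≤ J'')
    (y : cyclicExt N i J'') :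
    extProj N i h (extProj N i h' y) = extProj N i (h.trans h') y := by
  change (Ext.mk₀ _).comp ((Ext.mk₀ _).comp y (zero_add i)) (zero_add i) = _
  rw [Ext.mk₀_comp_mk₀_assoc, ← ModuleCat.ofHom_comp, Submodule.factor_comp]
  rfl

theorem mk₀_smul_comp {X N : ModuleCat.{u} A} {i : ℕ} (a : A) (f : X ⟶ X) (hf : f = a • 𝟙 X)
    (y : Ext X N i) : (Ext.mk₀ f).comp y (zero_add i) = a • y := by
  rw [hf, Ext.mk₀_smul, Ext.smul_comp, Ext.mk₀_id_comp]

theorem extMul_self (h : ∀ a, a ∈ J ↔ x * a ∈ J) (y : cyclicExt N i J) :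
    extMul N i h y = x • y := by
  refine mk₀_smul_comp x _ ?_ y
  refine ModuleCat.hom_ext (LinearMap.ext fun z => ?_)
  obtain ⟨a, rfl⟩ := Submodule.Quotient.mk_surjective _ z
  rfl

theorem extProj_extMul (h : ∀ a, a ∈ K ↔ x * a ∈ J) (hJ : J ≤ K) (y : cyclicExt N i J) :
    extProj N i hJ (extMul N i h y) = x • y := by
  change (Ext.mk₀ _).comp ((Ext.mk₀ _).comp y (zero_add i)) (zero_add i) = _
  rw [Ext.mk₀_comp_mk₀_assoc]
  refine mk₀_smul_comp x _ ?_ y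
  refine ModuleCat.hom_ext (LinearMap.ext fun z => ?_)
  obtain ⟨a, rfl⟩ := Submodule.Quotient.mk_surjective _ z
  rfl

theorem smul_cyclicExt {a : A} (ha : a ∈ J) (y : cyclicExt N i J) : a • y = 0 := by
  rw [← mk₀_smul_comp a (0 : ModuleCat.of A (A ⧸ J) ⟶ _) ?_ y]
  · simp
  · refine ModuleCat.hom_ext (LinearMap.ext fun z => ?_)
    obtain ⟨b, rfl⟩ := Submodule.Quotient.mk_surjective _ z
    change 0 = Submodule.Quotient.mk (a * b)
    exact ((Submodule.Quotient.mk_eq_zero _).2 (Ideal.mul_mem_right _ _ ha)).symm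

theorem subsingleton_cyclicExt_mid (h : ∀ a, a ∈ K ↔ x * a ∈ J)
    (h₁ : Subsingleton (cyclicExt N i K)) (h₂ : Subsingleton (cyclicExt N i (J ⊔ Ideal.span {x}))) :
    Subsingleton (cyclicExt N i J) := by
  refine subsingleton_of_forall_eq 0 fun y => ?_
  obtain ⟨z, rfl⟩ := extMul_eq_zero h (Subsingleton.elim (extMul N i h y) 0)
  rw [Subsingleton.elim z 0, map_zero]

theorem extMul_surjective (h : ∀ a, a ∈ K ↔ x * a ∈ J)
    (h₂ : Subsingleton (cyclicExt N (i + 1) (J ⊔ Ideal.span {x}))) :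
    Function.Surjective (extMul N i h) := fun _ =>
  extDelta_eq_zero h (Subsingleton.elim _ _)

theorem extMul_injective (h : ∀ a, a ∈ K ↔ x * a ∈ J)
    (h₂ : Subsingleton (cyclicExt N i (J ⊔ Ideal.span {x}))) :
    Function.Injective (extMul N i h) := by
  refine (injective_iff_map_eq_zero _).2 fun y hy => ?_
  obtain ⟨z, rfl⟩ := extMul_eq_zero h hy
  rw [Subsingleton.elim z 0, map_zero]

theorem extDelta_surjective (h : ∀ a, a ∈ K ↔ x * a ∈ J)
    (h₂ : Subsingleton (cyclicExt N (i + 1) J)) : Function.Surjective (extDelta N i h) := fun _ =>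
  extProj_eq_zero h (Subsingleton.elim _ _)

theorem extProj_sup_injective (h : ∀ a, a ∈ K ↔ x * a ∈ J)
    (h₁ : ∀ j < i, Subsingleton (cyclicExt N j K)) :
    Function.Injective (extProj N i (le_sup_left : J ≤ J ⊔ Ideal.span {x})) := by
  cases i with
  | zero => exact extProj_zero_injective _
  | succ i =>
    refine (injective_iff_map_eq_zero _).2 fun y hy => ?_
    obtain ⟨z, rfl⟩ := extProj_eq_zero h hy
    have := h₁ i i.lt_succ_self
    rw [Subsingleton.elim z 0, map_zero]

theorem subsingleton_cyclicExt_sup (h : ∀ a, a ∈ K ↔ x * a ∈ J)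
    (h₁ : ∀ j < i, Subsingleton (cyclicExt N j K)) (h₂ : Subsingleton (cyclicExt N i J)) :
    Subsingleton (cyclicExt N i (J ⊔ Ideal.span {x})) :=
  (extProj_sup_injective h h₁).subsingleton

theorem cyclicExt_top : Subsingleton (cyclicExt N i (⊤ : Ideal A)) := by
  refine subsingleton_of_forall_eq 0 fun y => ?_
  rw [← one_smul A y, smul_cyclicExt Submodule.mem_top]

theorem cyclicExt_bot : Subsingleton (cyclicExt N (i + 1) (⊥ : Ideal A)) := by
  have : Module.Projective A (A ⧸ (⊥ : Ideal A)) :=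
    Module.Projective.of_equiv (Submodule.quotEquivOfEqBot (⊥ : Ideal A) rfl).symm
  have : Projective (ModuleCat.of A (A ⧸ (⊥ : Ideal A))) :=
    (IsProjective.iff_projective _).1 this
  exact subsingleton_of_forall_eq 0 fun y => Ext.eq_zero_of_projective y

/-- The long exact sequence makes `x` act surjectively on the finitely generated module `Extⁱ(A/J,
N)`, so Nakayama's lemma applies. -/
theorem subsingleton_cyclicExt_of_regular [IsLocalRing A] [IsNoetherianRing A]
    [Module.Finite A N] (hx : x ∈ IsLocalRing.maximalIdeal A) (h : ∀ a, a ∈ J ↔ x * a ∈ J)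
    (h₂ : Subsingleton (cyclicExt N (i + 1) (J ⊔ Ideal.span {x}))) :
    Subsingleton (cyclicExt N i J) := by
  have htop : (⊤ : Submodule A (cyclicExt N i J)) = ⊥ := by
    refine Submodule.eq_bot_of_le_smul_of_le_jacobson_bot (Ideal.span {x}) _
      (Module.finite_def.1 inferInstance) ?_ ?_
    · intro y _
      obtain ⟨z, rfl⟩ := extMul_surjective h h₂ y
      rw [extMul_self]
      exact Submodule.smul_mem_smul (Ideal.mem_span_singleton_self x) trivial
    · rw [IsLocalRing.jacobson_eq_maximalIdeal _ bot_ne_top]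
      exact (Ideal.span_singleton_le_iff_mem _).2 hx
  exact (Submodule.subsingleton_iff A).1 (subsingleton_of_bot_eq_top htop.symm)

end CyclicExt

/-! ### Noetherian induction on ideals, and associated primes. -/

section Noetherian

variable {A : Type u} [CommRing A] [IsNoetherianRing A]

/-- This replaces prime filtrations: if `x y ∈ J` with `x, y ∉ J`, then both `(J : x)`, which
contains `y`, and `J + xA` are strictly larger than `J`. -/
theorem colon_induction {P : Ideal A → Prop} (htop : P ⊤)
    (hprime : ∀ J : Ideal A, J.IsPrime → (∀ J' > J, P J') → P J)
    (hcolon : ∀ (J K : Ideal A) (x : A), (∀ a, a ∈ K ↔ x * a ∈ J) → P K →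
      P (J ⊔ Ideal.span {x}) → P J) (J : Ideal A) : P J := by
  induction J using WellFoundedGT.induction with
  | _ J ih =>
    by_cases hJ : J = ⊤
    · rwa [hJ]
    by_cases hp : J.IsPrime
    · exact hprime J hp ih
    rw [Ideal.isPrime_iff] at hp
    push Not at hp
    obtain ⟨x, y, hxy, hx, hy⟩ := hp hJ
    refine hcolon J (Submodule.comap (LinearMap.mulLeft A x) J) x (fun a => Iff.rfl)
      (ih _ ?_) (ih _ ?_)
    · exact SetLike.lt_iff_le_and_exists.2 ⟨fun a ha => J.mul_mem_left x ha, y, hxy, hy⟩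
    · exact SetLike.lt_iff_le_and_exists.2
        ⟨le_sup_left, x, Ideal.mem_sup_right (Ideal.mem_span_singleton_self x), hx⟩

theorem exists_colon_of_isAssociatedPrime {J p : Ideal A}
    (hp : p ∈ associatedPrimes A (A ⧸ J)) : ∃ b, ∀ a, a ∈ p ↔ b * a ∈ J := by
  obtain ⟨-, x, rfl⟩ := isAssociatedPrime_iff.1 hp
  obtain ⟨b, rfl⟩ := Submodule.Quotient.mk_surjective _ x
  refine ⟨b, fun a => ?_⟩
  rw [Submodule.mem_colon_singleton, Submodule.mem_bot, ← Submodule.Quotient.mk_smul,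
    Submodule.Quotient.mk_eq_zero, smul_eq_mul, mul_comm]

theorem exists_prime_colon {J : Ideal A} (hJ : J ≠ ⊤) :
    ∃ p : Ideal A, p.IsPrime ∧ J ≤ p ∧ ∃ b, ∀ a, a ∈ p ↔ b * a ∈ J := by
  have : Nontrivial (A ⧸ J) := Ideal.Quotient.nontrivial_iff.2 hJ
  obtain ⟨p, hp⟩ := associatedPrimes.nonempty A (A ⧸ J)
  obtain ⟨b, hb⟩ := exists_colon_of_isAssociatedPrime hp
  exact ⟨p, hp.isPrime, fun a ha => (hb a).2 (J.mul_mem_left b ha), b, hb⟩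

/-- The zero divisors on `A/J` form the union of the finitely many associated primes; prime
avoidance puts `I` inside one of them. -/
theorem exists_prime_colon_of_zeroDivisors {I J : Ideal A}
    (h : ∀ t ∈ I, ∃ a ∉ J, t * a ∈ J) :
    ∃ p : Ideal A, p.IsPrime ∧ I ≤ p ∧ ∃ b, ∀ a, a ∈ p ↔ b * a ∈ J := by
  have hI : (I : Set A) ⊆ ⋃ p ∈ associatedPrimes A (A ⧸ J), (p : Set A) := by
    rw [biUnion_associatedPrimes_eq_zero_divisors]
    intro t ht
    obtain ⟨a, ha, hta⟩ := h t ht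
    exact ⟨Submodule.Quotient.mk a, fun h0 => ha ((Submodule.Quotient.mk_eq_zero _).1 h0),
      (Submodule.Quotient.mk_eq_zero _).2 hta⟩
  obtain ⟨p, hp, hIp⟩ := (Ideal.subset_union_prime_finite (associatedPrimes.finite A (A ⧸ J))
    (f := id) ⊤ ⊤ fun p hp _ _ => hp.isPrime).1 hI
  exact ⟨p, hp.isPrime, hIp, exists_colon_of_isAssociatedPrime hp⟩

end Noetherian

/-! ### Regular sequences and ideals primary to the maximal ideal. -/

section RegularChain

variable {A : Type u} [CommRing A] [IsLocalRing A]

/-- The ideal `J'` arises from `J` by adjoining `d` elements of the maximal ideal that form a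
regular sequence on `A/J`. -/
inductive RegularChain : Ideal A → ℕ → Ideal A → Prop
  | refl (J : Ideal A) : RegularChain J 0 J
  | step {J J' : Ideal A} {d : ℕ} (t : A) (ht : t ∈ IsLocalRing.maximalIdeal A)
      (hreg : ∀ a, a ∈ J ↔ t * a ∈ J) (h : RegularChain (J ⊔ Ideal.span {t}) d J') :
      RegularChain J (d + 1) J'

/-- Every prime ideal that contains `J` is maximal. -/
def IsMaxPrimary (J : Ideal A) : Prop :=
  ∀ p : Ideal A, p.IsPrime → J ≤ p → p = IsLocalRing.maximalIdeal A

theorem IsMaxPrimary.mono {J J' : Ideal A} (h : IsMaxPrimary J) (hJ : J ≤ J') : IsMaxPrimary J' :=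
  fun p hp hJp => h p hp (hJ.trans hJp)

theorem RegularChain.ne_top {J J' : Ideal A} {d : ℕ} (h : RegularChain J d J') (hJ : J ≠ ⊤) :
    J' ≠ ⊤ := by
  induction h with
  | refl => exact hJ
  | step t ht _ _ ih =>
    refine ih (ne_top_of_le_ne_top (IsLocalRing.maximalIdeal.isMaximal A).ne_top
      (sup_le (IsLocalRing.le_maximalIdeal hJ) ((Ideal.span_singleton_le_iff_mem _).2 ht)))

theorem RegularChain.le {J J' : Ideal A} {d : ℕ} (h : RegularChain J d J') : J ≤ J' := by
  induction h with
  | refl => exact le_rfl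
  | step _ _ _ _ ih => exact le_sup_left.trans ih

theorem RegularChain.exists_span {J J' : Ideal A} {d : ℕ} (h : RegularChain J d J') :
    ∃ S : Finset A, S.card ≤ d ∧ J' = J ⊔ Ideal.span S := by
  classical
  induction h with
  | refl => exact ⟨∅, le_rfl, by simp⟩
  | step t ht _ _ ih =>
    obtain ⟨S, hS, rfl⟩ := ih
    refine ⟨insert t S, (Finset.card_insert_le _ _).trans (Nat.succ_le_succ hS), ?_⟩
    rw [Finset.coe_insert, Ideal.span_insert, sup_assoc]

theorem IsMaxPrimary.exists_colon [IsNoetherianRing A] {J : Ideal A} (h : IsMaxPrimary J)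
    (hJ : J ≠ ⊤) : ∃ b, ∀ a, a ∈ IsLocalRing.maximalIdeal A ↔ b * a ∈ J := by
  obtain ⟨p, hp, hJp, b, hb⟩ := exists_prime_colon hJ
  exact ⟨b, h p hp hJp ▸ hb⟩

/-- A regular sequence is extended until `𝔪` consists of zero divisors; then `𝔪` is an associated
prime of the last quotient, which has depth zero. -/
theorem exists_regularChain [IsNoetherianRing A] {J : Ideal A} (hJ : J ≠ ⊤) :
    ∃ d J', RegularChain J d J' ∧ ∃ b, ∀ a, a ∈ IsLocalRing.maximalIdeal A ↔ b * a ∈ J' := by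
  induction J using WellFoundedGT.induction with
  | _ J ih =>
    by_cases h : ∀ t ∈ IsLocalRing.maximalIdeal A, ∃ a ∉ J, t * a ∈ J
    · obtain ⟨p, hp, hmp, b, hb⟩ := exists_prime_colon_of_zeroDivisors h
      obtain rfl := (IsLocalRing.maximalIdeal.isMaximal A).eq_of_le hp.ne_top hmp
      exact ⟨0, J, .refl J, b, hb⟩
    · push Not at h
      obtain ⟨t, ht, hreg⟩ := h
      have hreg' : ∀ a, a ∈ J ↔ t * a ∈ J := fun a =>
        ⟨fun ha => J.mul_mem_left t ha, fun ha => by_contra fun h => hreg a h ha⟩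
      have htJ : t ∉ J := fun h => hJ ((Ideal.eq_top_iff_one J).2 ((hreg' 1).2 (by simpa using h)))
      obtain ⟨d, J', h, hb⟩ := ih (J ⊔ Ideal.span {t})
        (SetLike.lt_iff_le_and_exists.2
          ⟨le_sup_left, t, Ideal.mem_sup_right (Ideal.mem_span_singleton_self t), htJ⟩)
        (RegularChain.ne_top (.step t ht hreg' (.refl _)) hJ)
      exact ⟨d + 1, J', .step t ht hreg' h, hb⟩

end RegularChain

/-! ### Vanishing of Ext over a local ring. -/

section LocalExt

open IsLocalRing

variable {A : Type u} [CommRing A]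

theorem not_subsingleton_cyclicExt_zero {N : Type u} [AddCommGroup N] [Module A N] {J : Ideal A}
    {f : (A ⧸ J) →ₗ[A] N} (hf : f ≠ 0) :
    ¬ Subsingleton (cyclicExt (ModuleCat.of A N) 0 J) := by
  intro h
  have h' := (Abelian.Ext.homEquiv₀ (X := ModuleCat.of A (A ⧸ J))
    (Y := ModuleCat.of A N)).symm.subsingleton
  exact hf (congrArg ModuleCat.Hom.hom (Subsingleton.elim (ModuleCat.ofHom f) 0))

theorem not_subsingleton_cyclicExt_zero_of_colon {p : Ideal A} (hp : p ≠ ⊤) {b : A}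
    (hb : ∀ a, a ∈ p ↔ b * a ∈ (⊥ : Ideal A)) :
    ¬ Subsingleton (cyclicExt (ModuleCat.of A A) 0 p) := by
  refine not_subsingleton_cyclicExt_zero
    (f := Submodule.liftQ p (LinearMap.mulLeft A b) fun a ha => (hb a).1 ha) fun h => ?_
  refine hp ((Ideal.eq_top_iff_one p).2 ((hb 1).2 ?_))
  exact LinearMap.congr_fun h (Submodule.Quotient.mk 1)

variable [IsLocalRing A]

/-- `n` is the largest degree in which some `Ext(A/J, A)` does not vanish, and
`Extⁿ(A/𝔪, A) ≠ 0`. -/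
structure IsTopExtDegree (A : Type u) [CommRing A] [IsLocalRing A] (n : ℕ) : Prop where
  subsingleton : ∀ i > n, ∀ J : Ideal A, Subsingleton (cyclicExt (ModuleCat.of A A) i J)
  nontrivial : ¬ Subsingleton (cyclicExt (ModuleCat.of A A) n (maximalIdeal A))

/-- For a prime `J ≠ 𝔪`, any `x ∈ 𝔪` outside `J` is regular on `A/J`, so vanishing in degree `i`
follows from vanishing for the larger ideal `J + xA` in degree `i + 1`. All degrees from `n` on are
therefore treated together. -/
theorem subsingleton_cyclicExt_of_maximalIdeal [IsNoetherianRing A] {N : ModuleCat.{u} A} [Module.Finite A N] {n : ℕ}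
    (h : ∀ i ≥ n, Subsingleton (cyclicExt N i (maximalIdeal A))) (J : Ideal A) :
    ∀ i ≥ n, Subsingleton (cyclicExt N i J) := by
  induction J using colon_induction with
  | htop => exact fun i _ => cyclicExt_top
  | hprime J hJ ih =>
    intro i hi
    rcases eq_or_ne J (maximalIdeal A) with rfl | hne
    · exact h i hi
    obtain ⟨x, hx, hxJ⟩ := SetLike.exists_of_lt (lt_of_le_of_ne (le_maximalIdeal hJ.ne_top) hne)
    have hreg : ∀ a, a ∈ J ↔ x * a ∈ J := fun a =>
      ⟨fun ha => J.mul_mem_left x ha, fun ha => (hJ.mem_or_mem ha).resolve_left hxJ⟩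
    exact subsingleton_cyclicExt_of_regular hx hreg (ih _ (SetLike.lt_iff_le_and_exists.2
      ⟨le_sup_left, x, Ideal.mem_sup_right (Ideal.mem_span_singleton_self x), hxJ⟩) _ (by omega))
  | hcolon J K x hK h₁ h₂ =>
    exact fun i hi => subsingleton_cyclicExt_mid hK (h₁ i hi) (h₂ i hi)

theorem exists_isTopExtDegree [IsNoetherianRing A] (h : ∃ n : ℕ, HasInjectiveDimensionLE (ModuleCat.of A A) n) :
    ∃ n, IsTopExtDegree A n := by
  classical
  obtain ⟨N, hN⟩ := h
  have hex : ∃ n, ∀ i ≥ n, Subsingleton (cyclicExt (ModuleCat.of A A) i (maximalIdeal A)) :=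
    ⟨N + 1, fun i hi => HasInjectiveDimensionLT.subsingleton _ (N + 1) i hi _⟩
  have hspec := Nat.find_spec hex
  have hmin := fun m => Nat.find_min hex (m := m)
  generalize Nat.find hex = n at hspec hmin
  cases n with
  | zero =>
    -- Vanishing from degree `0` on would give `Hom(A/0, A) = 0`.
    exact absurd (subsingleton_cyclicExt_of_maximalIdeal hspec ⊥ 0 le_rfl)
      (not_subsingleton_cyclicExt_zero_of_colon bot_ne_top (b := 1) (by simp))
  | succ n =>
    refine ⟨n, fun i hi J => subsingleton_cyclicExt_of_maximalIdeal hspec J i hi, fun h => ?_⟩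
    refine hmin n n.lt_succ_self fun i hi => ?_
    rcases hi.eq_or_lt with rfl | hi
    · exact h
    · exact hspec i hi

/-- Each regular element raises the bound on the nonvanishing degrees by at most one. -/
theorem RegularChain.subsingleton_cyclicExt_of_gt {N : ModuleCat.{u} A} {J J' : Ideal A} {d e : ℕ}
    (h : RegularChain J d J') (hJ : ∀ i > e, Subsingleton (cyclicExt N i J)) :
    ∀ i > e + d, Subsingleton (cyclicExt N i J') := by
  induction h generalizing e with
  | refl => exact hJ
  | step t ht hreg h ih =>
    have h1 := ih (e := e + 1) fun i hi => subsingleton_of_forall_eq 0 fun y => by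
      obtain ⟨i, rfl⟩ : ∃ j, i = j + 1 := ⟨i - 1, by omega⟩
      have := hJ i (by omega)
      have := hJ (i + 1) (by omega)
      obtain ⟨z, rfl⟩ := extDelta_surjective hreg this y
      rw [Subsingleton.elim z 0, map_zero]
    exact fun i hi => h1 i (by omega)

/-- The depth bound: `t ∈ P` kills `Extⁱ(A/P, A/J)`, yet `t` acts injectively there because
`Extⁱ⁻¹(A/P, A/(J + tA))` vanishes by induction. -/
theorem RegularChain.subsingleton_cyclicExt_of_lt {J J' P : Ideal A} {d : ℕ}
    (h : RegularChain J d J') (hP : J' ≤ P) :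
    ∀ i < d, Subsingleton (cyclicExt (ModuleCat.of A (A ⧸ J)) i P) := by
  induction h with
  | refl => exact fun i hi => absurd hi i.not_lt_zero
  | @step J J' d t ht hreg h ih =>
    intro i hi
    have htP : t ∈ P := hP (h.le (Ideal.mem_sup_right (Ideal.mem_span_singleton_self t)))
    have hS := colonComplex_shortExact hreg
    refine subsingleton_of_forall_eq 0 fun y => ?_
    have hy : y.comp (Abelian.Ext.mk₀ (colonComplex fun a => (hreg a).1).f) (add_zero i) = 0 := by
      have : (colonComplex fun a => (hreg a).1).f = t • 𝟙 _ := by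
        refine ModuleCat.hom_ext (LinearMap.ext fun z => ?_)
        obtain ⟨a, rfl⟩ := Submodule.Quotient.mk_surjective _ z
        rfl
      rw [this, ← Abelian.Ext.smul_eq_comp_mk₀]
      exact smul_cyclicExt htP y
    cases i with
    | zero =>
      have := hS.mono_f
      exact Abelian.Ext.postcomp_mk₀_injective_of_mono _
        (colonComplex fun a => (hreg a).1).f (hy.trans (by simp))
    | succ i =>
      obtain ⟨z, rfl⟩ := Abelian.Ext.covariant_sequence_exact₁ _ hS y hy rfl
      have := ih hP i (by omega)
      rw [Subsingleton.elim z 0, Abelian.Ext.zero_comp]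

end LocalExt

/-! ### Finite injective dimension, the Cohen–Macaulay property and duality. -/

section CohenMacaulay

open IsLocalRing

variable {A : Type u} [CommRing A] {n : ℕ}

theorem subsingleton_cyclicExt_of_iso {N N' : ModuleCat.{u} A} (e : N ≅ N') {i : ℕ} {J : Ideal A}
    (h : Subsingleton (cyclicExt N i J)) : Subsingleton (cyclicExt N' i J) := by
  refine subsingleton_of_forall_eq 0 fun y => ?_
  have hy : (y.comp (Abelian.Ext.mk₀ e.inv) (add_zero i)).comp
      (Abelian.Ext.mk₀ e.hom) (add_zero i) = y := by
    rw [Abelian.Ext.comp_assoc_of_third_deg_zero, Abelian.Ext.mk₀_comp_mk₀, e.inv_hom_id,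
      Abelian.Ext.comp_mk₀_id]
  rw [← hy, Subsingleton.elim (y.comp (Abelian.Ext.mk₀ e.inv) (add_zero i)) 0,
    Abelian.Ext.zero_comp]

variable [IsLocalRing A]

theorem RegularChain.subsingleton_cyclicExt_self {J P : Ideal A} {d : ℕ}
    (h : RegularChain ⊥ d J) (hP : J ≤ P) :
    ∀ i < d, Subsingleton (cyclicExt (ModuleCat.of A A) i P) := fun i hi =>
  subsingleton_cyclicExt_of_iso (Submodule.quotEquivOfEqBot (⊥ : Ideal A) rfl).toModuleIso
    (h.subsingleton_cyclicExt_of_lt hP i hi)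

/-- In the top degree Ext turns the embedding `A/𝔪 → A/J` into a surjection. -/
theorem IsTopExtDegree.not_subsingleton (hn : IsTopExtDegree A n) {J : Ideal A} {b : A}
    (hb : ∀ a, a ∈ maximalIdeal A ↔ b * a ∈ J) :
    ¬ Subsingleton (cyclicExt (ModuleCat.of A A) n J) := fun _ =>
  hn.nontrivial (extMul_surjective hb (hn.subsingleton _ n.lt_succ_self _)).subsingleton

/-- A local ring of finite injective dimension is Cohen--Macaulay: modulo a suitable regular
sequence, whose length is the top degree in which `Ext(-, A)` does not vanish, the maximal ideal
is the only prime ideal. -/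
theorem IsTopExtDegree.exists_regularChain [IsNoetherianRing A] (hn : IsTopExtDegree A n) :
    ∃ J : Ideal A, RegularChain ⊥ n J ∧ IsMaxPrimary J := by
  obtain ⟨d, J, h, b, hb⟩ := Unprojection.exists_regularChain (bot_ne_top (α := Ideal A))
  have hJ : J ≤ maximalIdeal A := le_maximalIdeal (h.ne_top bot_ne_top)
  -- `d ≤ n` because Ext vanishes below the depth `d`. Conversely `Extⁿ(A/J, A) ≠ 0`, since `A/𝔪`
  -- embeds in `A/J`, while Ext out of `A/J` vanishes above degree `d`.
  obtain rfl : d = n := by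
    apply le_antisymm
    · by_contra! hlt
      exact hn.nontrivial (h.subsingleton_cyclicExt_self hJ n hlt)
    · by_contra! hlt
      refine hn.not_subsingleton hb (h.subsingleton_cyclicExt_of_gt (e := 0) ?_ n (by omega))
      intro i hi
      obtain ⟨i, rfl⟩ : ∃ j, i = j + 1 := ⟨i - 1, by omega⟩
      exact cyclicExt_bot
  refine ⟨J, h, ?_⟩
  by_contra hmax
  have hne : {p : Ideal A | p.IsPrime ∧ J ≤ p ∧ p ≠ maximalIdeal A}.Nonempty := by
    simp only [IsMaxPrimary, not_forall] at hmax
    obtain ⟨p, hp, hJp, hpm⟩ := hmax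
    exact ⟨p, hp, hJp, hpm⟩
  -- With `P` maximal among the offending primes, `P + xA` is `𝔪`-primary, so its `Ext` in degree
  -- `n` is nonzero. But this group embeds in `Extⁿ(A/P, A)`, which is zero by Nakayama's lemma.
  obtain ⟨P, ⟨hP, hJP, hPm⟩, hPmax⟩ := set_has_maximal_iff_noetherian.2 ‹_› _ hne
  obtain ⟨x, hx, hxP⟩ := SetLike.exists_of_lt (lt_of_le_of_ne (le_maximalIdeal hP.ne_top) hPm)
  have hreg : ∀ a, a ∈ P ↔ x * a ∈ P := fun a =>
    ⟨fun ha => Ideal.mul_mem_left P x ha, fun ha => (hP.mem_or_mem ha).resolve_left hxP⟩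
  have hlt := h.subsingleton_cyclicExt_self hJP
  have hsup : Subsingleton (cyclicExt (ModuleCat.of A A) d (P ⊔ Ideal.span {x})) :=
    subsingleton_cyclicExt_sup hreg hlt
      (subsingleton_cyclicExt_of_regular hx hreg (hn.subsingleton _ d.lt_succ_self _))
  have hprim : IsMaxPrimary (P ⊔ Ideal.span {x}) := by
    intro q hq hPq
    by_contra hqm
    refine hPmax q ⟨hq, hJP.trans (le_sup_left.trans hPq), hqm⟩ (SetLike.lt_iff_le_and_exists.2
      ⟨le_sup_left.trans hPq, x, ?_, hxP⟩)
    exact hPq (Ideal.mem_sup_right (Ideal.mem_span_singleton_self x))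
  obtain ⟨c, hc⟩ := hprim.exists_colon
    (RegularChain.ne_top (.step x hx hreg (.refl _)) hP.ne_top)
  exact hn.not_subsingleton hc hsup

variable [IsNoetherianRing A]

theorem IsTopExtDegree.subsingleton_maximalIdeal (hn : IsTopExtDegree A n) {i : ℕ} (hi : i ≠ n) :
    Subsingleton (cyclicExt (ModuleCat.of A A) i (maximalIdeal A)) := by
  rcases hi.lt_or_gt with hi | hi
  · obtain ⟨J, hJ, -⟩ := hn.exists_regularChain
    exact hJ.subsingleton_cyclicExt_self (le_maximalIdeal (hJ.ne_top bot_ne_top)) i hi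
  · exact hn.subsingleton i hi _

theorem IsTopExtDegree.subsingleton_of_isMaxPrimary (hn : IsTopExtDegree A n) {i : ℕ}
    (hi : i ≠ n) (J : Ideal A) (hJ : IsMaxPrimary J) :
    Subsingleton (cyclicExt (ModuleCat.of A A) i J) := by
  induction J using colon_induction with
  | htop => exact cyclicExt_top
  | hprime J hp _ =>
    rw [hJ J hp le_rfl]
    exact hn.subsingleton_maximalIdeal hi
  | hcolon J K x hK h₁ h₂ =>
    exact subsingleton_cyclicExt_mid hK
      (h₁ (hJ.mono fun a ha => (hK a).2 (J.mul_mem_left x ha))) (h₂ (hJ.mono le_sup_left))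

/-- The ideal is enlarged one element at a time from `J` to `J'`; each kernel is a quotient of a
group of degree `n - 1` for an `𝔪`-primary ideal, which vanishes. -/
theorem IsTopExtDegree.extProj_injective (hn : IsTopExtDegree A n) {J J' : Ideal A}
    (hJ : IsMaxPrimary J) (h : J ≤ J') :
    Function.Injective (extProj (ModuleCat.of A A) n h) := by
  obtain ⟨K, ⟨hJK, hKJ', hK⟩, hmax⟩ := set_has_maximal_iff_noetherian.2
    (inferInstance : IsNoetherian A A)
    {K : Ideal A | ∃ (h₁ : J ≤ K) (_ : K ≤ J'),
      Function.Injective (extProj (ModuleCat.of A A) n h₁)}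
    ⟨J, le_rfl, h, fun y z hyz => by
      have hid : ∀ y, extProj (ModuleCat.of A A) n (le_refl J) y = y := fun y => by
        have : ModuleCat.ofHom (Submodule.factor (le_refl J)) = 𝟙 (ModuleCat.of A (A ⧸ J)) :=
          ModuleCat.hom_ext (LinearMap.ext fun z => by
            obtain ⟨a, rfl⟩ := Submodule.Quotient.mk_surjective _ z
            rfl)
        change (Abelian.Ext.mk₀ (ModuleCat.ofHom (Submodule.factor (le_refl J)))).comp y (zero_add n) = y
        rw [this, Abelian.Ext.mk₀_id_comp]
      rwa [hid, hid] at hyz⟩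
  obtain rfl : K = J' := by
    by_contra hne
    obtain ⟨x, hx, hxK⟩ := SetLike.exists_of_lt (lt_of_le_of_ne hKJ' hne)
    refine hmax (K ⊔ Ideal.span {x}) ⟨hJK.trans le_sup_left,
      sup_le hKJ' ((Ideal.span_singleton_le_iff_mem _).2 hx), ?_⟩ (SetLike.lt_iff_le_and_exists.2
        ⟨le_sup_left, x, Ideal.mem_sup_right (Ideal.mem_span_singleton_self x), hxK⟩)
    have hcol : ∀ a, a ∈ Submodule.comap (LinearMap.mulLeft A x) K ↔ x * a ∈ K := fun a => Iff.rfl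
    have hinj := extProj_sup_injective (N := ModuleCat.of A A) (i := n) hcol fun j hj =>
      hn.subsingleton_of_isMaxPrimary hj.ne _
        (hJ.mono (hJK.trans fun a ha => Ideal.mul_mem_left K x ha))
    intro y z hyz
    rw [← extProj_comp hJK le_sup_left, ← extProj_comp hJK le_sup_left] at hyz
    exact hinj (hK hyz)
  exact hK

/-- If `b ∉ J`, some multiple satisfies `(J : b c) = 𝔪`. Multiplication by `b c` on `Extⁿ(A/J, A)`
then factors as a surjection onto `Extⁿ(A/𝔪, A) ≠ 0` followed by an injection, so it is not zero. -/
theorem IsTopExtDegree.mem_of_smul_eq_zero (hn : IsTopExtDegree A n) {J : Ideal A}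
    (hJ : IsMaxPrimary J) {b : A}
    (hb : ∀ y : cyclicExt (ModuleCat.of A A) n J, b • y = 0) : b ∈ J := by
  by_contra hbJ
  have hK : IsMaxPrimary (Submodule.comap (LinearMap.mulLeft A b) J) :=
    hJ.mono fun a ha => J.mul_mem_left b ha
  obtain ⟨c, hc⟩ := hK.exists_colon fun h => hbJ (by
    have : (1 : A) ∈ Submodule.comap (LinearMap.mulLeft A b) J := h ▸ Submodule.mem_top
    simpa using this)
  have hbc : ∀ a, a ∈ maximalIdeal A ↔ (b * c) * a ∈ J := fun a => by
    rw [hc, mul_assoc]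
    rfl
  have hJm : J ≤ maximalIdeal A := fun a ha => (hbc a).2 (J.mul_mem_left _ ha)
  refine hn.nontrivial (subsingleton_of_forall_eq 0 fun y => ?_)
  obtain ⟨z, rfl⟩ := extMul_surjective hbc (hn.subsingleton _ n.lt_succ_self _) y
  apply hn.extProj_injective hJ hJm
  rw [extProj_extMul hbc hJm, mul_comm, mul_smul, hb, smul_zero, map_zero]

theorem IsTopExtDegree.subsingleton_of_regularChain (hn : IsTopExtDegree A n) {J J' : Ideal A}
    {d : ℕ} (h : RegularChain J d J') (hJ' : IsMaxPrimary J') :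
    ∀ i, i + d ≠ n → Subsingleton (cyclicExt (ModuleCat.of A A) i J) := by
  induction h with
  | refl => exact fun i hi => hn.subsingleton_of_isMaxPrimary hi _ hJ'
  | step t ht hreg h ih =>
    exact fun i hi => subsingleton_cyclicExt_of_regular ht hreg (ih hJ' _ (by omega))

theorem IsTopExtDegree.mem_of_smul_eq_zero_of_regularChain (hn : IsTopExtDegree A n)
    {J J' : Ideal A} {d : ℕ} (h : RegularChain J d J') (hJ' : IsMaxPrimary J') :
    ∀ i, i + d = n → ∀ b : A, (∀ y : cyclicExt (ModuleCat.of A A) i J, b • y = 0) → b ∈ J := by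
  induction h with
  | refl =>
    rintro i rfl b hb
    exact hn.mem_of_smul_eq_zero hJ' hb
  | @step J J' d t ht hreg h ih =>
    intro i hi
    have hinj := extMul_injective (i := i) hreg
      (hn.subsingleton_of_regularChain h hJ' i (by omega))
    have hsurj := extDelta_surjective (i := i) hreg
      (hn.subsingleton_of_regularChain (.step t ht hreg h) hJ' (i + 1) (by omega))
    -- Put `E = Extⁱ(A/J, A)`. An annihilator `b` of `E` kills its image `Extⁱ⁺¹(A/(J + tA), A)`, so
    -- `b = j + t c` with `j ∈ J`. Since `t` is injective on `E`, also `c` kills `E`, and Nakayama's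
    -- lemma finishes.
    have hann : Module.annihilator A (cyclicExt (ModuleCat.of A A) i J) ≤
        J ⊔ Ideal.span {t} • Module.annihilator A (cyclicExt (ModuleCat.of A A) i J) := by
      intro b hb
      rw [Module.mem_annihilator] at hb
      have hbt : b ∈ J ⊔ Ideal.span {t} := ih hJ' (i + 1) (by omega) b fun y => by
        obtain ⟨z, rfl⟩ := hsurj y
        rw [← map_smul, hb, map_zero]
      obtain ⟨j, hj, c, hc, rfl⟩ := Submodule.mem_sup.1 hbt
      obtain ⟨c, rfl⟩ := Ideal.mem_span_singleton'.1 hc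
      rw [mul_comm]
      refine Submodule.add_mem_sup hj (Submodule.smul_mem_smul (Ideal.mem_span_singleton_self t) ?_)
      rw [Module.mem_annihilator]
      intro y
      apply hinj
      rw [extMul_self, map_zero, smul_smul, mul_comm]
      have := hb y
      rwa [add_smul, smul_cyclicExt hj, zero_add] at this
    have hle := Submodule.le_of_le_smul_of_le_jacobson_bot
      (IsNoetherian.noetherian (Module.annihilator A (cyclicExt (ModuleCat.of A A) i J)))
      (by
        rw [IsLocalRing.jacobson_eq_maximalIdeal _ bot_ne_top]
        exact (Ideal.span_singleton_le_iff_mem _).2 ht) hann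
    exact fun b hb => hle (Module.mem_annihilator.2 hb)

/-- `A/J` is supported on primes whose distance to the maximal ideal is at least `n - i` if
`Extⁱ(A/J, A) ≠ 0`. -/
theorem IsTopExtDegree.exists_le_coheight (hn : IsTopExtDegree A n) (J : Ideal A) :
    ∀ i, ¬ Subsingleton (cyclicExt (ModuleCat.of A A) i J) →
      ∃ P : PrimeSpectrum A, J ≤ P.asIdeal ∧ (n : ℕ∞) ≤ i + Order.coheight P := by
  induction J using colon_induction with
  | htop => exact fun i hi => absurd cyclicExt_top hi
  | hprime J hJ ih =>
    intro i hi
    rcases eq_or_ne J (maximalIdeal A) with rfl | hne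
    · obtain rfl : i = n := by_contra fun h => hi (hn.subsingleton_maximalIdeal h)
      exact ⟨⟨_, hJ⟩, le_rfl, le_self_add⟩
    obtain ⟨x, hx, hxJ⟩ := SetLike.exists_of_lt (lt_of_le_of_ne (le_maximalIdeal hJ.ne_top) hne)
    have hreg : ∀ a, a ∈ J ↔ x * a ∈ J := fun a =>
      ⟨fun ha => J.mul_mem_left x ha, fun ha => (hJ.mem_or_mem ha).resolve_left hxJ⟩
    have hlt : J < J ⊔ Ideal.span {x} := SetLike.lt_iff_le_and_exists.2
      ⟨le_sup_left, x, Ideal.mem_sup_right (Ideal.mem_span_singleton_self x), hxJ⟩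
    obtain ⟨P, hP, hle⟩ := ih _ hlt (i + 1) fun h =>
      hi (subsingleton_cyclicExt_of_regular hx hreg h)
    refine ⟨⟨J, hJ⟩, le_rfl, hle.trans ?_⟩
    have := Order.coheight_add_one_le (a := P) (b := (⟨J, hJ⟩ : PrimeSpectrum A))
      (hlt.trans_le hP)
    calc ((i + 1 : ℕ) : ℕ∞) + Order.coheight P = i + (Order.coheight P + 1) := by
          push_cast; ring
      _ ≤ _ := by gcongr
  | hcolon J K x hK h₁ h₂ =>
    intro i hi
    by_cases h : Subsingleton (cyclicExt (ModuleCat.of A A) i K)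
    · obtain ⟨P, hP, hle⟩ := h₂ i fun h' => hi (subsingleton_cyclicExt_mid hK h h')
      exact ⟨P, le_sup_left.trans hP, hle⟩
    · obtain ⟨P, hP, hle⟩ := h₁ i h
      exact ⟨P, le_trans (fun a ha => (hK a).2 (J.mul_mem_left x ha)) hP, hle⟩

/-- Krull's height theorem: `𝔪` is minimal over an ideal with `n` generators. -/
theorem IsTopExtDegree.height_maximalIdeal_le (hn : IsTopExtDegree A n) :
    (maximalIdeal A).height ≤ n := by
  obtain ⟨J, hJ, hprim⟩ := hn.exists_regularChain
  obtain ⟨S, hS, rfl⟩ := hJ.exists_span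
  rw [bot_sup_eq] at *
  refine (Ideal.height_le_card_of_mem_minimalPrimes_span_finset (s := S)
    ⟨⟨inferInstance, le_maximalIdeal (hJ.ne_top bot_ne_top)⟩, fun q hq _ => ?_⟩).trans
      (by exact_mod_cast hS)
  exact (hprim q hq.1 hq.2).ge

/-- An ideal of positive height contains a regular element. -/
theorem IsTopExtDegree.exists_regular (hn : IsTopExtDegree A n) {I : Ideal A}
    (hI : I.height ≠ 0) : ∃ q ∈ I, IsSMulRegular A q := by
  by_contra! h
  obtain ⟨p, hp, hIp, b, hb⟩ := exists_prime_colon_of_zeroDivisors (I := I) (J := ⊥) (by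
    intro t ht
    have := h t ht
    rw [isSMulRegular_iff_right_eq_zero_of_smul] at this
    push Not at this
    obtain ⟨a, ha, ha0⟩ := this
    exact ⟨a, ha0, ha⟩)
  -- An associated prime `p` of `A` has `Hom(A/p, A) ≠ 0`, so some `P ⊇ p ⊇ I` has coheight at least
  -- `n`. Its height is at least `1`, which exceeds the dimension bound `n`.
  obtain ⟨P, hP, hle⟩ := hn.exists_le_coheight p 0
    (not_subsingleton_cyclicExt_zero_of_colon hp.ne_top hb)
  have h1 : 1 ≤ Order.height P := by
    rw [← PrimeSpectrum.height_eq_orderHeight]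
    exact (Order.one_le_iff_ne_zero.2 hI).trans (Ideal.height_mono (hIp.trans hP))
  have h2 : ((Order.height P + Order.coheight P : ℕ∞) : WithBot ℕ∞) ≤ ringKrullDim A := by
    rw [ringKrullDim, Order.krullDim_eq_iSup_height_add_coheight_of_nonempty]
    exact WithBot.coe_le_coe.2 (le_iSup (fun P => Order.height P + Order.coheight P) P)
  rw [← maximalIdeal_height_eq_ringKrullDim, WithBot.coe_le_coe] at h2
  have h3 : (1 + n : ℕ∞) ≤ n := by
    refine le_trans ?_ (h2.trans hn.height_maximalIdeal_le)
    rw [Nat.cast_zero, zero_add] at hle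
    gcongr
  norm_cast at h3
  omega

end CohenMacaulay

/-! ### Lifting regular sequences and primary ideals from `A/I` to `A`. -/

section Quotient

open IsLocalRing

variable {A : Type u} [CommRing A] [IsLocalRing A] (I : Ideal A) [IsLocalRing (A ⧸ I)]

theorem comap_maximalIdeal_quotient :
    (maximalIdeal (A ⧸ I)).comap (Ideal.Quotient.mk I) = maximalIdeal A :=
  have := Ideal.comap_isMaximal_of_surjective (Ideal.Quotient.mk I) Ideal.Quotient.mk_surjective
    (K := maximalIdeal (A ⧸ I))
  eq_maximalIdeal this

variable {I}

theorem RegularChain.comap {J J' : Ideal (A ⧸ I)} {d : ℕ} (h : RegularChain J d J') :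
    RegularChain (J.comap (Ideal.Quotient.mk I)) d (J'.comap (Ideal.Quotient.mk I)) := by
  induction h with
  | refl => exact .refl _
  | @step J J' d t ht hreg h ih =>
    obtain ⟨t, rfl⟩ := Ideal.Quotient.mk_surjective t
    refine .step t ?_ (fun a => ?_) ?_
    · rw [← comap_maximalIdeal_quotient I]
      exact ht
    · rw [Ideal.mem_comap, Ideal.mem_comap, map_mul]
      exact hreg _
    · convert ih using 1
      refine le_antisymm (sup_le (Ideal.comap_mono le_sup_left) ?_) fun a ha => ?_
      · rw [Ideal.span_singleton_le_iff_mem, Ideal.mem_comap]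
        exact Ideal.mem_sup_right (Ideal.mem_span_singleton_self _)
      · obtain ⟨j, hj, c, hc, hjc⟩ := Submodule.mem_sup.1 (Ideal.mem_comap.1 ha)
        obtain ⟨c, rfl⟩ := Ideal.mem_span_singleton'.1 hc
        obtain ⟨c, rfl⟩ := Ideal.Quotient.mk_surjective c
        rw [← sub_add_cancel a (c * t)]
        refine Submodule.add_mem_sup ?_ (Ideal.mul_mem_left _ c (Ideal.mem_span_singleton_self t))
        rw [Ideal.mem_comap, map_sub, ← hjc, map_mul, add_sub_cancel_right]
        exact hj

theorem IsMaxPrimary.comap {J : Ideal (A ⧸ I)} (h : IsMaxPrimary J) :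
    IsMaxPrimary (J.comap (Ideal.Quotient.mk I)) := by
  intro p hp hJp
  have hIp : RingHom.ker (Ideal.Quotient.mk I) ≤ p := le_trans (fun a ha => by
    rw [Ideal.mem_comap, (RingHom.mem_ker).1 ha]
    exact J.zero_mem) hJp
  have hp' := Ideal.map_isPrime_of_surjective Ideal.Quotient.mk_surjective hIp
  rw [← comap_maximalIdeal_quotient I, ← h _ hp'
    (by simpa [Ideal.map_comap_of_surjective _ Ideal.Quotient.mk_surjective] using
      Ideal.map_mono (f := Ideal.Quotient.mk I) hJp),
    Ideal.comap_map_of_surjective _ Ideal.Quotient.mk_surjective]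
  exact (sup_eq_left.2 hIp).symm

/-- If the local ring `A/I` is Gorenstein, then the `A`-module `A/I` is Cohen--Macaulay. -/
theorem exists_regularChain_of_isGorensteinLocalRing (hD : IsGorensteinLocalRing (A ⧸ I)) :
    ∃ d J, RegularChain I d J ∧ IsMaxPrimary J := by
  have := hD.isNoetherianRing
  obtain ⟨n, hn⟩ := exists_isTopExtDegree hD.finite_injectiveDimension
  obtain ⟨J, hJ, hprim⟩ := hn.exists_regularChain
  refine ⟨n, _, ?_, hprim.comap⟩
  convert hJ.comap
  exact (Ideal.mk_ker (I := I)).symm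

end Quotient

/-! ### `Hom(I, A)/A` as `Ext¹(A/I, A)`, and its annihilator. -/

section CanonicalModule

open IsLocalRing

variable {A : Type u} [CommRing A] {I : Ideal A}

theorem GeneratesHomModA.exists_eq {s : I →ₗ[A] A} (hs : GeneratesHomModA I s) (h : I →ₗ[A] A) :
    ∃ a b : A, h = a • Submodule.subtype I + b • s := by
  have hmem : (Submodule.span A {Submodule.subtype I}).mkQ h ∈
      Submodule.span A {(Submodule.span A {Submodule.subtype I}).mkQ s} := by
    rw [hs]
    trivial
  obtain ⟨b, hb⟩ := Submodule.mem_span_singleton.1 hmem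
  rw [← map_smul, Submodule.mkQ_apply, Submodule.mkQ_apply, eq_comm, Submodule.Quotient.eq] at hb
  obtain ⟨a, ha⟩ := Submodule.mem_span_singleton.1 hb
  exact ⟨a, b, by rw [ha, sub_add_cancel]⟩

theorem exists_mul_eq {M : Type u} [AddCommGroup M] [Module A M] {q : A} (hq : IsSMulRegular A q)
    (g : M →ₗ[A] A) (hg : ∀ m, g m ∈ Ideal.span {q}) : ∃ h : M →ₗ[A] A, ∀ m, q * h m = g m := by
  let e := LinearEquiv.ofInjective (LinearMap.mulLeft A q) hq
  refine ⟨e.symm.toLinearMap ∘ₗ g.codRestrict _ fun m => ?_, fun m => ?_⟩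
  · obtain ⟨c, hc⟩ := Ideal.mem_span_singleton'.1 (hg m)
    exact ⟨c, (mul_comm q c).trans hc⟩
  · exact congrArg Subtype.val (e.apply_symm_apply (g.codRestrict _ _ m))

/-- The complex `I → A → A/I`. -/
abbrev idealComplex (I : Ideal A) : ShortComplex (ModuleCat.{u} A) where
  X₁ := ModuleCat.of A I
  X₂ := ModuleCat.of A A
  X₃ := ModuleCat.of A (A ⧸ I)
  f := ModuleCat.ofHom (Submodule.subtype I)
  g := ModuleCat.ofHom (Submodule.mkQ I)
  zero := ModuleCat.hom_ext (LinearMap.ext fun a => (Submodule.Quotient.mk_eq_zero I).2 a.2)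

theorem idealComplex_shortExact (I : Ideal A) : (idealComplex I).ShortExact :=
  ModuleCat.shortComplex_shortExact _
    (by
      rw [LinearMap.exact_iff]
      simp)
    (Submodule.injective_subtype I) (Submodule.mkQ_surjective I)

theorem exists_eq_smul_subtype (h : Subsingleton (cyclicExt (ModuleCat.of A A) 1 I))
    (g : I →ₗ[A] A) : ∃ r : A, g = r • Submodule.subtype I := by
  obtain ⟨y, hy⟩ := Abelian.Ext.contravariant_sequence_exact₁ (idealComplex_shortExact I)
    (ModuleCat.of A A) (Abelian.Ext.mk₀ (ModuleCat.ofHom g)) (n₁ := 1) rfl (Subsingleton.elim _ _)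
  obtain ⟨k, rfl⟩ := (Abelian.Ext.mk₀_bijective _ _).2 y
  rw [Abelian.Ext.mk₀_comp_mk₀] at hy
  have hk := congrArg ModuleCat.Hom.hom ((Abelian.Ext.mk₀_bijective _ _).1 hy)
  refine ⟨k.hom 1, LinearMap.ext fun a => ?_⟩
  have := LinearMap.congr_fun hk a
  refine this.symm.trans ?_
  change k.hom (a : A) = k.hom 1 * a
  rw [mul_comm, ← smul_eq_mul, ← map_smul, smul_eq_mul, mul_one]

/-- Each class is the connecting image of some `g = c i + d s`, and `b g` is a multiple of `i`,
hence extends to `A` and has zero image. -/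
theorem smul_cyclicExt_one {s : I →ₗ[A] A} (hs : GeneratesHomModA I s) {a b : A}
    (hb : b • s = a • Submodule.subtype I) (y : cyclicExt (ModuleCat.of A A) 1 I) : b • y = 0 := by
  have hP : Projective (ModuleCat.of A A) := (IsProjective.iff_projective A).1 inferInstance
  have hS := idealComplex_shortExact I
  obtain ⟨z, rfl⟩ := Abelian.Ext.contravariant_sequence_exact₃ hS
    (ModuleCat.of A A) y (Abelian.Ext.eq_zero_of_projective _) (n₀ := 0) rfl
  obtain ⟨g, rfl⟩ := (Abelian.Ext.mk₀_bijective _ _).2 z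
  obtain ⟨c, d, hcd⟩ := hs.exists_eq g.hom
  have hg : b • g = (idealComplex I).f ≫ ((b * c + d * a) • 𝟙 (ModuleCat.of A A)) := by
    refine ModuleCat.hom_ext ?_
    have : b • g.hom = (b * c + d * a) • Submodule.subtype I := by
      rw [hcd, smul_add, smul_comm b d s, hb, smul_smul, smul_smul, add_smul]
    refine Eq.trans this ?_
    rfl
  rw [← Abelian.Ext.comp_smul, ← Abelian.Ext.mk₀_smul, hg, ← Abelian.Ext.mk₀_comp_mk₀,
    ShortComplex.ShortExact.extClass_comp_assoc]

/-- A height one prime `p ⊇ I` is minimal over `qA`, so `p = (qA : y)` for some `y ∉ qA`. Then `y/q`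
maps `I` to `A`; were it multiplication by an element of `A`, `y` would lie in `qA`. -/
theorem not_subsingleton_cyclicExt_one [IsNoetherianRing A] (hI : I.height = 1) {q : A}
    (hqI : q ∈ I) (hq : IsSMulRegular A q) :
    ¬ Subsingleton (cyclicExt (ModuleCat.of A A) 1 I) := by
  intro h
  obtain ⟨p, hp, hIp, hp1⟩ := Ideal.exists_isPrime_height_eq (n := 1) (by exact_mod_cast hI)
  have hmin : p ∈ (Ideal.span {q}).minimalPrimes := by
    refine Ideal.mem_minimalPrimes_of_height_le
      ((Ideal.span_singleton_le_iff_mem _).2 (hIp hqI)) ?_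
    rw [hp1]
    refine Ideal.one_le_height_span_singleton_of_mem_nonZeroDivisors ?_
    exact mem_nonZeroDivisors_iff_right.2 fun x hx =>
      hq.right_eq_zero_of_smul (by rwa [smul_eq_mul, mul_comm])
  have hass := Module.associatedPrimes.minimalPrimes_annihilator_subset_associatedPrimes A (A ⧸ Ideal.span {q})
    (by rwa [Ideal.annihilator_quotient])
  obtain ⟨y, hy⟩ := exists_colon_of_isAssociatedPrime hass
  obtain ⟨g, hg⟩ := exists_mul_eq hq (LinearMap.mulLeft A y ∘ₗ Submodule.subtype I)
    fun a => (hy a).1 (hIp a.2)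
  obtain ⟨r, rfl⟩ := exists_eq_smul_subtype h g
  have hr : q * (r * q) = y * q := hg ⟨q, hqI⟩
  have hyr : y = r * q := hq ((mul_comm q y).trans hr.symm)
  refine hp.ne_top ((Ideal.eq_top_iff_one p).2 ((hy 1).2 ?_))
  rw [mul_one, hyr]
  exact Ideal.mul_mem_left _ r (Ideal.mem_span_singleton_self q)

theorem exists_regular_of_isGorensteinLocalRing (hA : IsGorensteinLocalRing A)
    (hI : I.height = 1) : ∃ q ∈ I, IsSMulRegular A q := by
  have := hA.isLocalRing
  have := hA.isNoetherianRing
  obtain ⟨n, hn⟩ := exists_isTopExtDegree hA.finite_injectiveDimension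
  exact hn.exists_regular (by simp [hI])

/-- The module `Hom(I, A)/A`, which is a canonical module of `A/I`, is a faithful `A/I`-module. -/
theorem mem_of_smul_eq_smul_subtype (hA : IsGorensteinLocalRing A) (hI : I.height = 1)
    (hD : IsGorensteinLocalRing (A ⧸ I)) {s : I →ₗ[A] A} (hs : GeneratesHomModA I s) {a b : A}
    (hb : b • s = a • Submodule.subtype I) : b ∈ I := by
  have := hA.isLocalRing
  have := hA.isNoetherianRing
  have := hD.isLocalRing
  obtain ⟨n, hn⟩ := exists_isTopExtDegree hA.finite_injectiveDimension
  obtain ⟨d, J, hJ, hprim⟩ := exists_regularChain_of_isGorensteinLocalRing hD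
  obtain ⟨q, hqI, hq⟩ := exists_regular_of_isGorensteinLocalRing hA hI
  -- Ext of the Cohen–Macaulay module `A/I` lives only in degree `n - d`, and `Ext¹` is nonzero.
  have hd : 1 + d = n := by
    by_contra hne
    exact not_subsingleton_cyclicExt_one hI hqI hq (hn.subsingleton_of_regularChain hJ hprim 1 hne)
  exact hn.mem_of_smul_eq_zero_of_regularChain hJ hprim 1 hd b (smul_cyclicExt_one hs hb)

end CanonicalModule

/-! ### Universal property and generators of `R₁`. -/

section SymmetricQuotient

variable {A : Type u} [CommRing A] {Q : Type u} [AddCommGroup Q] [Module A Q] {e : Q}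

theorem R1.ι_self : R1.ι (A := A) e e = 1 := by
  change Ideal.Quotient.mk _ (SymmetricAlgebra.ι A Q e) = Ideal.Quotient.mk _ 1
  rw [Ideal.Quotient.eq]
  exact Ideal.subset_span rfl

theorem R1.exists_lift {B : Type u} [CommRing B] [Algebra A B] (l : Q →ₗ[A] B) (hl : l e = 1) :
    ∃ L : R1 (A := A) Q e →ₐ[A] B, ∀ x, L (R1.ι e x) = l x := by
  refine ⟨Ideal.Quotient.liftₐ _ (SymmetricAlgebra.lift l) ?_, fun x => ?_⟩
  · intro a ha
    refine (Ideal.span_le (I := RingHom.ker (SymmetricAlgebra.lift l))).2 ?_ ha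
    rintro _ rfl
    simp [RingHom.mem_ker, hl]
  · exact SymmetricAlgebra.lift_ι_apply l x

theorem R1.eq_top_of_ι_mem (S : Subalgebra A (R1 (A := A) Q e)) (h : ∀ x, R1.ι e x ∈ S) :
    S = ⊤ := by
  refine eq_top_iff.2 fun y _ => ?_
  obtain ⟨y, rfl⟩ := Ideal.Quotient.mk_surjective y
  induction y using SymmetricAlgebra.induction with
  | algebraMap r => exact S.algebraMap_mem r
  | ι x => exact h x
  | mul a b ha hb =>
    rw [map_mul]
    exact S.mul_mem (ha trivial) (hb trivial)
  | add a b ha hb =>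
    rw [map_add]
    exact S.add_mem (ha trivial) (hb trivial)

theorem R1.aeval_surjective {s : Q} (hs : ∀ x : Q, ∃ a b : A, x = a • e + b • s) :
    Function.Surjective (aeval (R1.ι e s) : A[X] →ₐ[A] R1 (A := A) Q e) := by
  rw [← AlgHom.range_eq_top]
  refine R1.eq_top_of_ι_mem _ fun x => ?_
  obtain ⟨a, b, rfl⟩ := hs x
  refine ⟨a • 1 + b • X, ?_⟩
  change aeval (R1.ι e s) (a • 1 + b • X : A[X]) = _
  rw [map_add, map_smul, map_smul, map_one, aeval_X, map_add, map_smul, map_smul, R1.ι_self]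

/-- The universal property turns `l` into an algebra map `R₁ → A[S]/K` whose composite with `aeval`
is the quotient map. -/
theorem R1.ker_aeval {s : Q} {K : Ideal A[X]}
    (hK : ∀ p ∈ K, aeval (R1.ι (A := A) e s) p = 0) (l : Q →ₗ[A] A[X] ⧸ K) (hl : l e = 1)
    (hls : l s = Ideal.Quotient.mk K X) (p : A[X]) :
    aeval (R1.ι (A := A) e s) p = 0 ↔ p ∈ K := by
  refine ⟨fun hp => ?_, hK p⟩
  obtain ⟨L, hL⟩ := R1.exists_lift l hl
  have h1 : L (aeval (R1.ι (A := A) e s) p) = Ideal.Quotient.mkₐ A K (aeval X p) := by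
    rw [← aeval_algHom_apply, ← aeval_algHom_apply, hL, hls]
    rfl
  rw [hp, map_zero, aeval_X_left_apply] at h1
  exact Ideal.Quotient.eq_zero_iff_mem.1 h1.symm

end SymmetricQuotient

/-! ### Relations and torsion in the Kustin–Miller ring. -/

section KustinMiller

variable {A : Type u} [CommRing A] {I : Ideal A} {r : ℕ} {f : Fin r → I} (s : I →ₗ[A] A)

/-- The linear map `I → A[S]`, `b ↦ S b - s(b)`. -/
noncomputable def linearRelation : I →ₗ[A] A[X] where
  toFun b := X * C (b : A) - C (s b)
  map_add' a b := by
    simp only [Submodule.coe_add, map_add]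
    ring
  map_smul' a b := by
    simp only [map_smul, smul_eq_mul, Polynomial.smul_eq_C_mul, RingHom.id_apply,
      Submodule.coe_smul, map_mul]
    ring

/-- The linear map `I[S] → A[S]`, `b ↦ S b - s(b)`. -/
noncomputable def relation : (ℕ →₀ I) →ₗ[A] A[X] :=
  Finsupp.lsum A fun n => LinearMap.mulLeft A (X ^ n) ∘ₗ linearRelation s

variable {s}

theorem relation_single (n : ℕ) (b : I) :
    relation s (Finsupp.single n b) = X ^ n * (X * C (b : A) - C (s b)) := by
  simp [relation, linearRelation]

theorem coeff_relation (β : ℕ →₀ I) (n : ℕ) :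
    (relation s β).coeff (n + 1) = β n - s (β (n + 1)) := by
  induction β using Finsupp.induction_linear with
  | zero => simp
  | add β γ hβ hγ =>
    rw [map_add, coeff_add, hβ, hγ]
    simp only [Finsupp.add_apply, map_add, Submodule.coe_add]
    ring
  | single k b =>
    rw [relation_single, mul_sub, ← mul_assoc, ← pow_succ, coeff_sub, coeff_X_pow_mul',
      coeff_X_pow_mul', coeff_C, coeff_C, Finsupp.single_apply, Finsupp.single_apply]
    congr 1
    · split_ifs <;> first | rfl | omega
    · split_ifs <;> first | rfl | omega | simp

theorem linearRelation_mem (hf : Ideal.span (Set.range fun j => (f j : A)) = I) (b : I) :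
    X * C (b : A) - C (s b) ∈ kustinMillerIdeal (fun j => (f j : A)) (fun j => s (f j)) := by
  have hspan : b ∈ Submodule.span A (Set.range f) := by
    have hmap : (Submodule.span A (Set.range f)).map (Submodule.subtype I) = I := by
      rw [Submodule.map_span, ← Set.range_comp]
      exact hf
    have hb : (b : A) ∈ (Submodule.span A (Set.range f)).map (Submodule.subtype I) :=
      hmap.symm ▸ b.2
    obtain ⟨c, hc, hcb⟩ := hb
    exact Subtype.ext hcb ▸ hc
  refine (Submodule.span_le (p := Submodule.comap (linearRelation s) (Submodule.restrictScalars A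
    (kustinMillerIdeal (fun j => (f j : A)) (fun j => s (f j)))))).2 ?_ hspan
  rintro _ ⟨j, rfl⟩
  exact Ideal.subset_span ⟨j, rfl⟩

theorem relation_mem (hf : Ideal.span (Set.range fun j => (f j : A)) = I) (β : ℕ →₀ I) :
    relation s β ∈ kustinMillerIdeal (fun j => (f j : A)) (fun j => s (f j)) := by
  induction β using Finsupp.induction_linear with
  | zero => simp
  | add β γ hβ hγ => exact map_add (relation s) β γ ▸ add_mem hβ hγ
  | single k b =>
    rw [relation_single]
    exact Ideal.mul_mem_left _ _ (linearRelation_mem hf b)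

/-- The range of `relation s` is stable under multiplication by `S`, which is a shift of `β`, so it
is an ideal. -/
theorem exists_relation_eq {p : A[X]}
    (hp : p ∈ kustinMillerIdeal (fun j => (f j : A)) (fun j => s (f j))) :
    ∃ β, relation s β = p := by
  have hX : ∀ β, X * relation s β = relation s (β.mapDomain Nat.succ) := fun β => by
    induction β using Finsupp.induction_linear with
    | zero => simp
    | add β γ hβ hγ => rw [map_add, mul_add, hβ, hγ, Finsupp.mapDomain_add, map_add]
    | single k b => rw [Finsupp.mapDomain_single, relation_single, relation_single, pow_succ']; ring
  induction hp using Submodule.span_induction with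
  | mem x hx =>
    obtain ⟨j, rfl⟩ := hx
    exact ⟨Finsupp.single 0 (f j), by rw [relation_single, pow_zero, one_mul]⟩
  | zero => exact ⟨0, map_zero _⟩
  | add x y _ _ hx hy =>
    obtain ⟨β, rfl⟩ := hx
    obtain ⟨γ, rfl⟩ := hy
    exact ⟨β + γ, map_add _ _ _⟩
  | smul a x _ hx =>
    induction a using Polynomial.induction_on' with
    | add a b ha hb =>
      obtain ⟨β, hβ⟩ := ha
      obtain ⟨γ, hγ⟩ := hb
      exact ⟨β + γ, by rw [map_add, hβ, hγ, add_smul]⟩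
    | monomial n a =>
      induction n with
      | zero =>
        obtain ⟨β, rfl⟩ := hx
        exact ⟨a • β, by rw [map_smul, monomial_zero_left, smul_eq_C_mul, smul_eq_mul]⟩
      | succ n ih =>
        obtain ⟨β, hβ⟩ := ih
        refine ⟨β.mapDomain Nat.succ, ?_⟩
        rw [← hX, hβ, smul_eq_mul, smul_eq_mul, ← mul_assoc, X_mul_monomial]

/-- The ring `A[S]/(S b - s(b))` has no torsion with respect to the elements of `A` that are
regular on both `A` and `A/I`. -/
theorem mem_kustinMillerIdeal_of_C_mul_mem (hf : Ideal.span (Set.range fun j => (f j : A)) = I)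
    {t : A} (ht : IsSMulRegular A t) (htI : IsSMulRegular (A ⧸ I) t) {p : A[X]}
    (hp : C t * p ∈ kustinMillerIdeal (fun j => (f j : A)) (fun j => s (f j))) :
    p ∈ kustinMillerIdeal (fun j => (f j : A)) (fun j => s (f j)) := by
  obtain ⟨β, hβ⟩ := exists_relation_eq hp
  obtain ⟨N, hN⟩ : ∃ N, ∀ n ≥ N, β n = 0 := by
    refine ⟨β.support.sup id + 1, fun n hn => ?_⟩
    by_contra h
    have := Finset.le_sup (f := id) (Finsupp.mem_support_iff.2 h)
    simp only [id_eq] at this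
    omega
  clear hp
  induction N generalizing β p with
  | zero =>
    have hβ0 : β = 0 := Finsupp.ext fun n => hN n n.zero_le
    rw [hβ0, map_zero] at hβ
    have hp0 : p = 0 := by
      ext n
      refine ht ?_
      have := congrArg (fun p => coeff p n) hβ
      simpa using this.symm
    rw [hp0]
    exact Ideal.zero_mem _
  | succ N ih =>
    -- As `β` vanishes from `N + 1` on, the coefficient of `S ^ (N + 1)` sees only `β N`. Regularity
    -- of `t` on `A/I` puts `p.coeff (N + 1)` in `I`, so subtracting its relation from `p` removes
    -- `β N`.
    have hcoeff : t * p.coeff (N + 1) = β N := by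
      rw [← coeff_C_mul, ← hβ, coeff_relation, hN (N + 1) le_rfl, map_zero, sub_zero]
    have hmem : p.coeff (N + 1) ∈ I := by
      refine (Submodule.Quotient.mk_eq_zero I).1 (htI ?_)
      change t • Submodule.Quotient.mk (p.coeff (N + 1)) = t • (0 : A ⧸ I)
      rw [smul_zero, ← Submodule.Quotient.mk_smul, Submodule.Quotient.mk_eq_zero, smul_eq_mul,
        hcoeff]
      exact (β N).2
    have hβN : β N = t • (⟨p.coeff (N + 1), hmem⟩ : I) := Subtype.ext hcoeff.symm
    have h := ih (p := p - relation s (Finsupp.single N ⟨p.coeff (N + 1), hmem⟩))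
      (β - Finsupp.single N (β N)) (by
        rw [map_sub, hβ, mul_sub, hβN, ← Finsupp.smul_single, map_smul, smul_eq_C_mul]) (by
        intro n hn
        rcases hn.eq_or_lt with rfl | hn
        · simp
        · simp [hN n hn, hn.ne])
    exact (Submodule.sub_mem_iff_left _ (relation_mem hf _)).1 h

theorem exists_linearMap_kustinMillerUnprojection
    (hf : Ideal.span (Set.range fun j => (f j : A)) = I)
    (hs : GeneratesHomModA I s) {q : A} (hqI : q ∈ I) (hq : IsSMulRegular A q)
    (hfaithful : ∀ a b : A, b • s = a • Submodule.subtype I → b ∈ I) :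
    ∃ l : (I →ₗ[A] A) →ₗ[A]
        KustinMillerUnprojection (fun j => (f j : A)) (fun j => s (f j)),
      l (Submodule.subtype I) = 1 ∧ l s = Ideal.Quotient.mk _ X := by
  let π : A × A →ₗ[A] I →ₗ[A] A := LinearMap.coprod
    (LinearMap.toSpanSingleton A _ (Submodule.subtype I)) (LinearMap.toSpanSingleton A _ s)
  let k : A × A →ₗ[A] KustinMillerUnprojection (fun j => (f j : A)) (fun j => s (f j)) :=
    LinearMap.coprod (LinearMap.toSpanSingleton A _ 1)
      (LinearMap.toSpanSingleton A _ (Ideal.Quotient.mk _ X))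
  have hπ : Function.Surjective π := fun h => by
    obtain ⟨a, b, rfl⟩ := hs.exists_eq h
    exact ⟨(a, b), rfl⟩
  -- If `a i + b s = 0`, then `b ∈ I` by faithfulness. Evaluating at `q` gives `a q = -b s(q) = -q
  -- s(b)`, so `a = -s(b)`: the relation is the one that becomes `S b - s(b)`.
  have hk : LinearMap.ker π ≤ LinearMap.ker k := by
    rintro ⟨a, b⟩ hab
    replace hab : a • Submodule.subtype I + b • s = 0 := hab
    have hb : b ∈ I := hfaithful (-a) b
      ((eq_neg_of_add_eq_zero_right hab).trans (neg_smul a (Submodule.subtype I)).symm)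
    have h1 : a * q + b * s ⟨q, hqI⟩ = 0 := LinearMap.congr_fun hab ⟨q, hqI⟩
    have h2 : b * s ⟨q, hqI⟩ = q * s ⟨b, hb⟩ := by
      rw [← smul_eq_mul, ← smul_eq_mul, ← map_smul, ← map_smul]
      exact congrArg s (Subtype.ext (mul_comm b q))
    have h3 : a = -s ⟨b, hb⟩ := hq (by
      simp only [smul_eq_mul]
      linear_combination h1 - h2)
    have h4 : a • (1 : A[X]) + b • X = X * C ((⟨b, hb⟩ : I) : A) - C (s ⟨b, hb⟩) := by
      rw [h3, smul_eq_C_mul, smul_eq_C_mul, map_neg]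
      ring
    refine Eq.trans ?_ (Ideal.Quotient.eq_zero_iff_mem.2 (linearRelation_mem (s := s) hf ⟨b, hb⟩))
    rw [← h4]
    rfl
  have hl : ∀ z, ((LinearMap.ker π).liftQ k hk ∘ₗ
      (π.quotKerEquivOfSurjective hπ).symm.toLinearMap) (π z) = k z := fun z => by
    have : (π.quotKerEquivOfSurjective hπ).symm (π z) = Submodule.Quotient.mk z :=
      (LinearEquiv.symm_apply_eq _).2 rfl
    rw [LinearMap.comp_apply, LinearEquiv.coe_coe, this]
    rfl
  have hπ1 : π (1, 0) = Submodule.subtype I := by simp [π]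
  have hπ2 : π (0, 1) = s := by simp [π]
  refine ⟨(LinearMap.ker π).liftQ k hk ∘ₗ
    (π.quotKerEquivOfSurjective hπ).symm.toLinearMap, ?_, ?_⟩
  · rw [← hπ1, hl]
    simp [k]
  · refine ((congrArg _ hπ2.symm).trans (hl (0, 1))).trans ?_
    simp [k]

end KustinMiller

/-! ### The identification of `Hom(I, A)` with the extension module. -/

section HomToExt

variable {A : Type u} [CommRing A] {I : Ideal A} {q : A}

theorem homToExt_subtype (hqI : q ∈ I) :
    homToExt I q hqI (Submodule.subtype I) = ExtModule.incl (projection I) q 1 := by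
  refine Subtype.ext (Prod.ext (mul_one q).symm ?_)
  refine LinearMap.ext fun y => ?_
  obtain ⟨x, rfl⟩ := Ideal.Quotient.mk_surjective y
  change Ideal.Quotient.mk (Ideal.span {q}) (x * q) = 0
  exact Ideal.Quotient.eq_zero_iff_mem.2
    (Ideal.mul_mem_left _ x (Ideal.mem_span_singleton_self q))

/-- Since `q h(x) = x h(q)`, the value `c = h(q)` determines `h`. Conversely `α` vanishes on the
class of `x ∈ I`, so `x c ∈ qA` and `h(x) = x c / q` is defined. -/
theorem homToExt_bijective (hqI : q ∈ I) (hq : IsSMulRegular A q) :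
    Function.Bijective (homToExt I q hqI) := by
  constructor
  · refine (injective_iff_map_eq_zero _).2 fun h hh => LinearMap.ext fun x => hq ?_
    have h0 : h ⟨q, hqI⟩ = 0 := congrArg (fun z => z.1.1) hh
    change q • h x = q • 0
    rw [← map_smul, smul_zero, show q • x = (x : A) • (⟨q, hqI⟩ : I) from
      Subtype.ext (mul_comm q x), map_smul, h0, smul_zero]
  · rintro ⟨⟨c, α⟩, hα⟩
    have hα1 : Ideal.Quotient.mk (Ideal.span {q}) c = α (Ideal.Quotient.mk I 1) := hα
    have hx : ∀ x : A, α (Ideal.Quotient.mk I x) = Ideal.Quotient.mk (Ideal.span {q}) (x * c) := by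
      intro x
      have : Ideal.Quotient.mk I x = x • Ideal.Quotient.mk I 1 := by
        rw [← Ideal.Quotient.mk_eq_mk, ← Ideal.Quotient.mk_eq_mk, ← Submodule.Quotient.mk_smul,
          smul_eq_mul, mul_one]
      rw [this, map_smul, ← hα1]
      rfl
    obtain ⟨h, hh⟩ := exists_mul_eq hq (LinearMap.mulRight A c ∘ₗ Submodule.subtype I) fun x => by
      refine Ideal.Quotient.eq_zero_iff_mem.1 ((hx x).symm.trans ?_)
      rw [Ideal.Quotient.eq_zero_iff_mem.2 x.2, map_zero]
    have hc : h ⟨q, hqI⟩ = c := hq (hh ⟨q, hqI⟩)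
    refine ⟨h, Subtype.ext (Prod.ext hc ?_)⟩
    refine LinearMap.ext fun y => ?_
    obtain ⟨x, rfl⟩ := Ideal.Quotient.mk_surjective y
    refine Eq.trans ?_ (hx x).symm
    change Ideal.Quotient.mk (Ideal.span {q}) (x * h ⟨q, hqI⟩) = _
    rw [hc]

end HomToExt

/-! ### Algebras generated by one element. -/

theorem aeval_quotientMk {A B : Type u} [CommRing A] [CommRing B] [Algebra A B] (J : Ideal B)
    (b : B) (p : A[X]) :
    aeval (Ideal.Quotient.mk J b) p = Ideal.Quotient.mk J (aeval b p) :=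
  aeval_algHom_apply (Ideal.Quotient.mkₐ A J) b p

theorem aeval_quotientMk_surjective {A B : Type u} [CommRing A] [CommRing B] [Algebra A B]
    (J : Ideal B) {b : B} (hb : Function.Surjective (aeval (R := A) b)) :
    Function.Surjective (aeval (R := A) (Ideal.Quotient.mk J b)) := by
  intro y
  obtain ⟨y, rfl⟩ := Ideal.Quotient.mk_surjective y
  obtain ⟨p, rfl⟩ := hb y
  exact ⟨p, aeval_quotientMk J b p⟩

theorem exists_quotient_algEquiv {A B : Type u} [CommRing A] [CommRing B] [Algebra A B]
    {K : Ideal A[X]} {b : B} (hb : Function.Surjective (aeval (R := A) b))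
    (hK : RingHom.ker (aeval (R := A) b) = K) :
    ∃ e : (A[X] ⧸ K) ≃ₐ[A] B, e (Ideal.Quotient.mk K X) = b := by
  subst hK
  exact ⟨Ideal.quotientKerAlgEquivOfSurjective hb, aeval_X b⟩

theorem exists_algEquiv_of_ker_eq {A B B' : Type u} [CommRing A] [CommRing B] [Algebra A B]
    [CommRing B'] [Algebra A B'] {I : Ideal A} {s : I →ₗ[A] A} (hs : GeneratesHomModA I s)
    {l : (I →ₗ[A] A) →ₗ[A] B} {l' : (I →ₗ[A] A) →ₗ[A] B'} (hl : l (Submodule.subtype I) = 1)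
    (hl' : l' (Submodule.subtype I) = 1) (hsurj : Function.Surjective (aeval (R := A) (l s)))
    (hsurj' : Function.Surjective (aeval (R := A) (l' s)))
    (hker : RingHom.ker (aeval (R := A) (l s)) = RingHom.ker (aeval (R := A) (l' s))) :
    ∃ e : B ≃ₐ[A] B', ∀ h, e (l h) = l' h := by
  obtain ⟨e, he⟩ := exists_quotient_algEquiv hsurj hker
  obtain ⟨e', he'⟩ := exists_quotient_algEquiv hsurj' rfl
  have hes : e' (e.symm (l s)) = l' s := by
    rw [← he, e.symm_apply_apply, he']
  refine ⟨e.symm.trans e', fun h => ?_⟩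
  obtain ⟨a, b, rfl⟩ := hs.exists_eq h
  simp only [map_add, map_smul, hl, hl', map_one, AlgEquiv.trans_apply, hes]

/-! ### Passage from `R₁` to `unpr`. -/

section Unpr

variable {A : Type u} [CommRing A] {M : Type u} [AddCommGroup M] [Module A M] (φ : A →ₗ[A] M)
  (q : A)

theorem unpr.ι_incl : unpr.ι φ q (ExtModule.incl φ q 1) = 1 :=
  congrArg (Ideal.Quotient.mk (torsionIdeal (regularSubmonoid A M)
    (R1 (A := A) (ExtModule φ q) (ExtModule.incl φ q 1))))
    (R1.ι_self (A := A) (Q := ExtModule φ q) (e := ExtModule.incl φ q 1))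

theorem unpr.aeval_ι (x : ExtModule φ q) (p : A[X]) : aeval (unpr.ι φ q x) p =
    Ideal.Quotient.mk (torsionIdeal (regularSubmonoid A M)
      (R1 (A := A) (ExtModule φ q) (ExtModule.incl φ q 1)))
      (aeval (R1.ι (ExtModule.incl φ q 1) x) p) :=
  aeval_quotientMk (torsionIdeal (regularSubmonoid A M)
    (R1 (A := A) (ExtModule φ q) (ExtModule.incl φ q 1))) (R1.ι (ExtModule.incl φ q 1) x) p

theorem unpr.aeval_ι_surjective {x : ExtModule φ q}
    (hx : ∀ y : ExtModule φ q, ∃ a b : A, y = a • ExtModule.incl φ q 1 + b • x) :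
    Function.Surjective (aeval (R := A) (unpr.ι φ q x)) :=
  aeval_quotientMk_surjective (torsionIdeal (regularSubmonoid A M)
    (R1 (A := A) (ExtModule φ q) (ExtModule.incl φ q 1)))
    (R1.aeval_surjective (A := A) (Q := ExtModule φ q) (e := ExtModule.incl φ q 1) hx)

theorem unpr.aeval_ι_eq_zero_iff {x : ExtModule φ q} {K : Ideal A[X]}
    (hK : ∀ p : A[X], aeval (R1.ι (A := A) (ExtModule.incl φ q 1) x) p = 0 ↔ p ∈ K)
    (htf : ∀ t ∈ regularSubmonoid A M, ∀ p : A[X], C t * p ∈ K → p ∈ K) (p : A[X]) :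
    aeval (unpr.ι φ q x) p = 0 ↔ p ∈ K := by
  rw [unpr.aeval_ι, Ideal.Quotient.eq_zero_iff_mem]
  constructor
  · rintro ⟨t, ht, h⟩
    refine htf t ht p ((hK _).1 ?_)
    rw [← smul_eq_C_mul, map_smul]
    exact h
  · intro hp
    rw [(hK p).2 hp]
    exact Ideal.zero_mem _

end Unpr

/-! ### Comparison of `R₁`, `unpr` and the Kustin–Miller ring. -/

section KustinMillerIso

variable {A : Type u} [CommRing A] {I : Ideal A} {r : ℕ} {f : Fin r → I} {s : I →ₗ[A] A} {q : A}

theorem aeval_eq_zero_of_mem_kustinMillerIdeal {B : Type u} [CommRing B] [Algebra A B]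
    (l : (I →ₗ[A] A) →ₗ[A] B) (hl : l (Submodule.subtype I) = 1) {p : A[X]}
    (hp : p ∈ kustinMillerIdeal (fun j => (f j : A)) (fun j => s (f j))) :
    aeval (l s) p = 0 := by
  refine (Ideal.span_le (I := RingHom.ker (aeval (R := A) (l s)))).2 ?_ hp
  rintro _ ⟨j, rfl⟩
  -- Both sides send `x` to `s(f_j x)`.
  have hj : (f j : A) • s = s (f j) • Submodule.subtype I := LinearMap.ext fun x => by
    change (f j : A) • s x = s (f j) * x
    rw [← map_smul, mul_comm, ← smul_eq_mul, ← map_smul]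
    exact congrArg s (Subtype.ext (mul_comm _ _))
  have h := congrArg l hj
  rw [map_smul, map_smul, hl, Algebra.smul_def, Algebra.smul_def, mul_one] at h
  simp [RingHom.mem_ker, h]

theorem aeval_ι_eq_zero_iff (hf : Ideal.span (Set.range fun j => (f j : A)) = I)
    (hs : GeneratesHomModA I s) (hqI : q ∈ I) (hq : IsSMulRegular A q)
    (hfaithful : ∀ a b : A, b • s = a • Submodule.subtype I → b ∈ I)
    {Q : Type u} [AddCommGroup Q] [Module A Q] {e : Q} {j : (I →ₗ[A] A) →ₗ[A] Q}
    (hj : Function.Bijective j) (hje : j (Submodule.subtype I) = e) (p : A[X]) :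
    aeval (R1.ι (A := A) e (j s)) p = 0 ↔
      p ∈ kustinMillerIdeal (fun j => (f j : A)) (fun j => s (f j)) := by
  obtain ⟨l, hl, hls⟩ := exists_linearMap_kustinMillerUnprojection hf hs hqI hq hfaithful
  let j' := LinearEquiv.ofBijective j hj
  have hj' : ∀ h, j'.symm (j h) = h := j'.symm_apply_apply
  have h0 : ∀ p ∈ kustinMillerIdeal (fun j => (f j : A)) (fun j => s (f j)),
      aeval (R1.ι (A := A) e (j s)) p = 0 := fun p hp =>
    aeval_eq_zero_of_mem_kustinMillerIdeal (R1.ι (A := A) e ∘ₗ j)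
      (by rw [LinearMap.comp_apply, hje, R1.ι_self]) hp
  have h1 : (l ∘ₗ j'.symm.toLinearMap) e = 1 := by
    rw [← hje, LinearMap.comp_apply, LinearEquiv.coe_coe, hj', hl]
  have h2 : (l ∘ₗ j'.symm.toLinearMap) (j s) = Ideal.Quotient.mk _ X := by
    rw [LinearMap.comp_apply, LinearEquiv.coe_coe, hj', hls]
  exact R1.ker_aeval h0 (l ∘ₗ j'.symm.toLinearMap) h1 h2 p

theorem homToUnpr_subtype (hqI : q ∈ I) : homToUnpr I q hqI (Submodule.subtype I) = 1 :=
  (congrArg (unpr.ι (projection I) q) (homToExt_subtype hqI)).trans (unpr.ι_incl _ q)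

theorem psi2_surjective (hs : GeneratesHomModA I s) (hqI : q ∈ I) (hq : IsSMulRegular A q) :
    Function.Surjective (psi2 I q hqI s) :=
  unpr.aeval_ι_surjective (projection I) q (x := homToExt I q hqI s) fun y => by
    obtain ⟨h, rfl⟩ := (homToExt_bijective hqI hq).2 y
    obtain ⟨a, b, rfl⟩ := hs.exists_eq h
    exact ⟨a, b, by rw [map_add, map_smul, map_smul, homToExt_subtype]⟩

theorem ker_psi2 (hf : Ideal.span (Set.range fun j => (f j : A)) = I)
    (hs : GeneratesHomModA I s) (hqI : q ∈ I) (hq : IsSMulRegular A q)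
    (hfaithful : ∀ a b : A, b • s = a • Submodule.subtype I → b ∈ I) :
    RingHom.ker (psi2 I q hqI s) =
      kustinMillerIdeal (fun j => (f j : A)) (fun j => s (f j)) := by
  have hker := aeval_ι_eq_zero_iff hf hs hqI hq hfaithful (Q := ExtModule (projection I) q)
    (e := ExtModule.incl (projection I) q 1) (j := homToExt I q hqI) (homToExt_bijective hqI hq)
    (homToExt_subtype hqI)
  exact Ideal.ext (unpr.aeval_ι_eq_zero_iff (projection I) q hker fun t ht p =>
    mem_kustinMillerIdeal_of_C_mul_mem hf ht.1 ht.2)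

theorem ker_aeval_idealR1 (hf : Ideal.span (Set.range fun j => (f j : A)) = I)
    (hs : GeneratesHomModA I s) (hqI : q ∈ I) (hq : IsSMulRegular A q)
    (hfaithful : ∀ a b : A, b • s = a • Submodule.subtype I → b ∈ I) :
    RingHom.ker (aeval (R1.ι (Submodule.subtype I) s) : A[X] →ₐ[A] idealR1 I) =
      kustinMillerIdeal (fun j => (f j : A)) (fun j => s (f j)) :=
  Ideal.ext (aeval_ι_eq_zero_iff hf hs hqI hq hfaithful (Q := I →ₗ[A] A)
    (e := Submodule.subtype I) (j := LinearMap.id) Function.bijective_id rfl)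

theorem exists_idealR1_algEquiv (hs : GeneratesHomModA I s) (hqI : q ∈ I)
    (hsurj : Function.Surjective (psi2 I q hqI s))
    (hker : RingHom.ker (aeval (R1.ι (Submodule.subtype I) s) : A[X] →ₐ[A] idealR1 I) =
      RingHom.ker (psi2 I q hqI s)) :
    ∃ e : idealR1 I ≃ₐ[A] unprIdeal I q,
      ∀ h : I →ₗ[A] A, e (R1.ι (Submodule.subtype I) h) = homToUnpr I q hqI h :=
  exists_algEquiv_of_ker_eq hs (l := R1.ι (Submodule.subtype I)) (l' := homToUnpr I q hqI)
    R1.ι_self (homToUnpr_subtype hqI)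
    (R1.aeval_surjective (e := Submodule.subtype I) hs.exists_eq) hsurj hker

end KustinMillerIso

end Unprojection

/-! ### The theorem. -/

theorem mainTheorem1 {A : Type u} [CommRing A] (I : Ideal A)
    (hA : IsGorensteinLocalRing A) (hI : I.height = 1) (hD : IsGorensteinLocalRing (A ⧸ I))
    {r : ℕ} (f : Fin r → I) (hf : Ideal.span (Set.range fun j => (f j : A)) = I)
    (s : I →ₗ[A] A) (hs : Unprojection.GeneratesHomModA I s) :
    (∃ q ∈ I, IsSMulRegular A q) ∧
    ∀ (q : A) (hq : q ∈ I), IsSMulRegular A q →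
      Function.Surjective (Unprojection.psi2 I q hq s) ∧
      RingHom.ker (Unprojection.psi2 I q hq s) =
        Unprojection.kustinMillerIdeal (fun j => (f j : A)) (fun j => s (f j)) ∧
      (∃ e : Unprojection.KustinMillerUnprojection (fun j => (f j : A)) (fun j => s (f j)) ≃ₐ[A]
          Unprojection.unprIdeal I q,
        e (Ideal.Quotient.mk _ Polynomial.X) = Unprojection.homToUnpr I q hq s) ∧
      ∃ e : Unprojection.idealR1 I ≃ₐ[A] Unprojection.unprIdeal I q,
        ∀ h : I →ₗ[A] A,
          e (Unprojection.R1.ι (Submodule.subtype I) h) = Unprojection.homToUnpr I q hq h := by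
  refine ⟨Unprojection.exists_regular_of_isGorensteinLocalRing hA hI, fun q hqI hq => ?_⟩
  have hfaithful : ∀ a b : A, b • s = a • Submodule.subtype I → b ∈ I := fun _ _ hb =>
    Unprojection.mem_of_smul_eq_smul_subtype hA hI hD hs hb
  have hsurj := Unprojection.psi2_surjective hs hqI hq
  have hker := Unprojection.ker_psi2 hf hs hqI hq hfaithful
  have hR1 := Unprojection.ker_aeval_idealR1 hf hs hqI hq hfaithful
  refine ⟨hsurj, hker, ?_, ?_⟩
  · exact Unprojection.exists_quotient_algEquiv hsurj hker
  · exact Unprojection.exists_idealR1_algEquiv hs hqI hsurj (hR1.trans hker.symm)
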